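/- Setting. Let $(M,\omega)$ be a symplectic manifold, and let $*$ be a star product on $C^\infty(M)[[\lambda]]$ (complex-valued functions): $f*g=\sum_{n\ge0}\lambda^nM_n(f,g)$ with $\mathbb C$-bilinear $M_n:C^\infty(M)\times C^\infty(M)\to C^\infty(M)$, extended $\lambda$-bilinearly, which is associative, has $1$ as unit, is local ($\operatorname{supp}(f*g)\subseteq\operatorname{supp}f\cap\operatorname{supp}g$) and satisfies $M_0(f,g)=fg$ and $M_1(f,g)-M_1(g,f)=i\{f,g\}$. Write $M_k^-(f,g)=M_k(f,g)-M_k(g,f)$. The conventions are $\omega(X_f,\cdot)=df$ and $\{f,g\}=\omega(X_f,X_g)=df(X_g)$. Let $J\in C^\infty(M)$ be real-valued with $dJ\ne0$ at every point of $C:=J^{-1}(0)$, and let $i:C\hookrightarrow M$ be the inclusion. ($M$ is the neighbourhood of the constraint surface $C$ on which the construction takes place.) Let $\mathsf p:C^\infty(C)[[\lambda]]\to C^\infty(M)[[\lambda]]$ be any $\mathbb C[[\lambda]]$-linear map with $i^*\circ\mathsf p=\mathrm{Id}$, and put $\mathrm{prol}(f):=\mathsf p(i^*f)$. Define the following $\mathbb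 C[[\lambda]]$-submodules of $C^\infty(M)[[\lambda]]$: $$F=\{f:\mathrm{prol}(f)=f\},\qquad I=\{f:i^*f=0\},\qquad B=\{f:\{f,g\}\in I\ \ \forall g\in I\},$$ $$I^*=\{g*J: g\in C^\infty(M)[[\lambda]]\},\qquad B^*=\{f: f*g-g*f\in I^*\ \ \forall g\in I^*\}.$$ For $f\in C^\infty(M)[[\lambda]]$ let $\mathrm{pr}_J(f)$ be the unique series $h$ with $f-\mathrm{prol}(f)=h\cdot J$, and define operators on $C^\infty(M)[[\lambda]]$ by $$T_0=\mathrm{Id},\qquad T_n(f)=-\sum_{k=1}^nT_{n-k}\bigl(M_k(\mathrm{pr}_J(f),J)\bigr)\quad(n\ge1).$$ Let $\Phi_t$ be the (maximal, smooth) local flow of $X_J$, and suppose that there is a global transversal section $\sigma\subseteq C$ of the foliation of $C$ by the orbits of this flow: $\sigma$ is an embedded hypersurface of $C$ transversal to $X_J$, and every $p\in C$ can be written as $p=\Phi_{t(p)}(\mathfrak p(p))$ with a unique point $\mathfrak p(p)\in\sigma$ and a unique time $t(p)\in\mathbb R$. Statement. There is exactly one sequence of operators $S_n$ ($n\ge0$)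 on $C^\infty(M)[[\lambda]]$ such that $S_0=\mathrm{Id}$ and, for all $n\ge1$ and $f\in C^\infty(M)[[\lambda]]$, $$(S_nf)(p)=-i\int_0^{t(p)}\bigl(F_{n+1}[S_0,\dots,S_{n-1};T_0,\dots,T_n](f)\bigr)\bigl(\Phi_t(\mathfrak p(p))\bigr)\,dt\quad(p\in C),\qquad S_nf=\mathrm{prol}(S_nf),$$ where, for $n\ge2$, $$F_n[S_0,\dots,S_{n-2};T_0,\dots,T_{n-1}](f)=\sum_{k=2}^nM_k^-(J,S_{n-k}f)+\sum_{i=1}^{n-1}\sum_{k=1}^{n-i}T_i\bigl(M_k^-(J,S_{n-k-i}f)\bigr).$$ The operators $S_n$ are $\mathbb C[[\lambda]]$-linear, and $S=\sum_{n\ge0}\lambda^nS_n$ restricts to a $\mathbb C[[\lambda]]$-linear isomorphism from $B\cap F$ onto $B^*\cap F$. -/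

import Mathlib

open scoped Manifold ContDiff Topology PowerSeries

noncomputable section

set_option linter.unusedSectionVars false

namespace StarReduction

/-! ### Formal power series in the deformation parameter -/

section Formal

variable {R N L : Type*} [CommRing R] [Algebra ℂ R] [CommRing N] [Algebra ℂ N]
  [CommRing L] [Algebra ℂ L]

theorem coeff_formal_smul (c : ℂ⟦X⟧) (f : R⟦X⟧) (n : ℕ) :
    PowerSeries.coeff n (c • f) =
      ∑ p ∈ Finset.HasAntidiagonal.antidiagonal n, PowerSeries.coeff p.1 c • PowerSeries.coeff p.2 f := by
  rw [Algebra.smul_def, PowerSeries.algebraMap_apply'', PowerSeries.coeff_mul]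
  simp [Algebra.smul_def]

theorem sum_antidiagonal_swap₁₂ {G : Type*} [AddCommMonoid G] (n : ℕ) (F : ℕ → ℕ → ℕ → G) :
    ∑ p ∈ Finset.HasAntidiagonal.antidiagonal n, ∑ q ∈ Finset.HasAntidiagonal.antidiagonal p.2, F p.1 q.1 q.2 =
      ∑ p ∈ Finset.HasAntidiagonal.antidiagonal n, ∑ q ∈ Finset.HasAntidiagonal.antidiagonal p.2, F q.1 p.1 q.2 := by
  rw [Finset.sum_sigma', Finset.sum_sigma']
  refine Finset.sum_nbij' (fun x => ⟨(x.2.1, x.1.1 + x.2.2), (x.1.1, x.2.2)⟩)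
    (fun x => ⟨(x.2.1, x.1.1 + x.2.2), (x.1.1, x.2.2)⟩) ?_ ?_ ?_ ?_ ?_
  · rintro ⟨⟨a, b⟩, ⟨c, d⟩⟩ h
    simp only [Finset.mem_sigma, Finset.HasAntidiagonal.mem_antidiagonal] at h ⊢
    obtain ⟨h1, h2⟩ := h
    exact ⟨by omega, trivial⟩
  · rintro ⟨⟨a, b⟩, ⟨c, d⟩⟩ h
    simp only [Finset.mem_sigma, Finset.HasAntidiagonal.mem_antidiagonal] at h ⊢
    obtain ⟨h1, h2⟩ := h
    exact ⟨by omega, trivial⟩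
  · rintro ⟨⟨a, b⟩, ⟨c, d⟩⟩ h
    simp only [Finset.mem_sigma, Finset.HasAntidiagonal.mem_antidiagonal] at h ⊢
    obtain ⟨h1, rfl⟩ := h
    rfl
  · rintro ⟨⟨a, b⟩, ⟨c, d⟩⟩ h
    simp only [Finset.mem_sigma, Finset.HasAntidiagonal.mem_antidiagonal] at h ⊢
    obtain ⟨h1, rfl⟩ := h
    rfl
  · rintro ⟨⟨a, b⟩, ⟨c, d⟩⟩ h
    rfl

theorem sum_antidiagonal_assoc {G : Type*} [AddCommMonoid G] (n : ℕ) (F : ℕ → ℕ → ℕ → G) :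
    ∑ p ∈ Finset.HasAntidiagonal.antidiagonal n, ∑ q ∈ Finset.HasAntidiagonal.antidiagonal p.1, F q.1 q.2 p.2 =
      ∑ p ∈ Finset.HasAntidiagonal.antidiagonal n, ∑ q ∈ Finset.HasAntidiagonal.antidiagonal p.2, F p.1 q.1 q.2 := by
  rw [Finset.sum_sigma', Finset.sum_sigma']
  refine Finset.sum_nbij' (fun x => ⟨(x.2.1, x.2.2 + x.1.2), (x.2.2, x.1.2)⟩)
    (fun x => ⟨(x.1.1 + x.2.1, x.2.2), (x.1.1, x.2.1)⟩) ?_ ?_ ?_ ?_ ?_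
  · rintro ⟨⟨a, b⟩, ⟨c, d⟩⟩ h
    simp only [Finset.mem_sigma, Finset.HasAntidiagonal.mem_antidiagonal] at h ⊢
    obtain ⟨h1, h2⟩ := h
    exact ⟨by omega, trivial⟩
  · rintro ⟨⟨a, b⟩, ⟨c, d⟩⟩ h
    simp only [Finset.mem_sigma, Finset.HasAntidiagonal.mem_antidiagonal] at h ⊢
    obtain ⟨h1, h2⟩ := h
    exact ⟨by omega, trivial⟩
  · rintro ⟨⟨a, b⟩, ⟨c, d⟩⟩ h
    simp only [Finset.mem_sigma, Finset.HasAntidiagonal.mem_antidiagonal] at h ⊢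
    obtain ⟨h1, rfl⟩ := h
    rfl
  · rintro ⟨⟨a, b⟩, ⟨c, d⟩⟩ h
    simp only [Finset.mem_sigma, Finset.HasAntidiagonal.mem_antidiagonal] at h ⊢
    obtain ⟨h1, rfl⟩ := h
    rfl
  · rintro ⟨⟨a, b⟩, ⟨c, d⟩⟩ h
    rfl

/-- The `λ`-bilinear extension of a binary operation to formal power series:
`(∑ λ^i f_i, ∑ λ^j g_j) ↦ ∑ λ^(i+j) b(f_i, g_j)`. -/
def convolve (b : R → L → N) (f : R⟦X⟧) (g : L⟦X⟧) : N⟦X⟧ :=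
  PowerSeries.mk fun n => ∑ p ∈ Finset.HasAntidiagonal.antidiagonal n,
    b (PowerSeries.coeff p.1 f) (PowerSeries.coeff p.2 g)

/-- The formal sum `∑_k λ^k G_k` of a sequence of formal power series. -/
def formalSum (G : ℕ → R⟦X⟧) : R⟦X⟧ :=
  PowerSeries.mk fun n => ∑ p ∈ Finset.HasAntidiagonal.antidiagonal n, PowerSeries.coeff p.2 (G p.1)

theorem convolve_add_left {b : R → L → N} (hb : ∀ u v w, b (u + v) w = b u w + b v w)
    (f f' : R⟦X⟧) (g : L⟦X⟧) : convolve b (f + f') g = convolve b f g + convolve b f' g := by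
  ext n
  simp [convolve, hb, Finset.sum_add_distrib]

theorem convolve_smul_left {b : R → L → N} (hb : ∀ u v w, b (u + v) w = b u w + b v w)
    (hs : ∀ (a : ℂ) u w, b (a • u) w = a • b u w) (c : ℂ⟦X⟧) (f : R⟦X⟧) (g : L⟦X⟧) :
    convolve b (c • f) g = c • convolve b f g := by
  have hsum : ∀ (s : Finset (ℕ × ℕ)) (u : ℕ × ℕ → R) (w : L),
      b (∑ i ∈ s, u i) w = ∑ i ∈ s, b (u i) w := fun s u w =>
    map_sum (AddMonoidHom.mk' (fun x => b x w) fun x y => hb x y w) u s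
  ext n
  rw [coeff_formal_smul]
  simp only [convolve, PowerSeries.coeff_mk, coeff_formal_smul, hsum, hs, Finset.smul_sum]
  exact sum_antidiagonal_assoc n
    fun i j k => PowerSeries.coeff i c • b (PowerSeries.coeff j f) (PowerSeries.coeff k g)

theorem convolve_add_right {b : R → L → N} (hb : ∀ u v w, b w (u + v) = b w u + b w v)
    (f : R⟦X⟧) (g g' : L⟦X⟧) : convolve b f (g + g') = convolve b f g + convolve b f g' := by
  ext n
  simp [convolve, hb, Finset.sum_add_distrib]

theorem convolve_smul_right {b : R → L → N} (hb : ∀ u v w, b w (u + v) = b w u + b w v)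
    (hs : ∀ (a : ℂ) u w, b w (a • u) = a • b w u) (c : ℂ⟦X⟧) (f : R⟦X⟧) (g : L⟦X⟧) :
    convolve b f (c • g) = c • convolve b f g := by
  have hsum : ∀ (s : Finset (ℕ × ℕ)) (u : ℕ × ℕ → L) (w : R),
      b w (∑ i ∈ s, u i) = ∑ i ∈ s, b w (u i) := fun s u w =>
    map_sum (AddMonoidHom.mk' (fun x => b w x) fun x y => hb x y w) u s
  ext n
  rw [coeff_formal_smul]
  simp only [convolve, PowerSeries.coeff_mk, coeff_formal_smul, hsum, hs, Finset.smul_sum]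
  exact sum_antidiagonal_swap₁₂ n
    fun i j k => PowerSeries.coeff j c • b (PowerSeries.coeff i f) (PowerSeries.coeff k g)

theorem formalSum_add (G G' : ℕ → R⟦X⟧) :
    formalSum (fun k => G k + G' k) = formalSum G + formalSum G' := by
  ext n
  simp [formalSum, Finset.sum_add_distrib]

theorem formalSum_smul (c : ℂ⟦X⟧) (G : ℕ → R⟦X⟧) :
    formalSum (fun k => c • G k) = c • formalSum G := by
  ext n
  rw [coeff_formal_smul]
  simp only [formalSum, PowerSeries.coeff_mk, coeff_formal_smul, Finset.smul_sum]
  exact sum_antidiagonal_swap₁₂ n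
    fun i j k => PowerSeries.coeff j c • PowerSeries.coeff k (G i)

/-- Coefficientwise application of an algebra homomorphism, as a `ℂ⟦λ⟧`-linear map. -/
def mapSeries (φ : R →ₐ[ℂ] N) : R⟦X⟧ →ₗ[ℂ⟦X⟧] N⟦X⟧ where
  toFun f := PowerSeries.map (φ : R →+* N) f
  map_add' f g := map_add _ f g
  map_smul' c f := by
    ext n
    simp [coeff_formal_smul]

end Formal

/-! ### Smooth functions on a manifold and on a subset of it -/

section Smooth

variable (E : Type*) [NormedAddCommGroup E] [NormedSpace ℝ E]
  (M : Type*) [TopologicalSpace M] [ChartedSpace E M]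

/-- The algebra `C^∞(M)` of complex valued smooth functions on `M`. -/
def smoothAlgebra : Subalgebra ℂ (M → ℂ) where
  carrier := {f | ContMDiff 𝓘(ℝ, E) 𝓘(ℝ, ℂ) ∞ f}
  mul_mem' {f g} hf hg := by
    have hf' : ContMDiff 𝓘(ℝ, E) 𝓘(ℝ, ℂ) ∞ f := hf
    have hg' : ContMDiff 𝓘(ℝ, E) 𝓘(ℝ, ℂ) ∞ g := hg
    exact (contDiff_mul (𝕜 := ℝ) (𝔸 := ℂ)).contMDiff.comp (hf'.prodMk_space hg')
  add_mem' {f g} hf hg := by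
    have hf' : ContMDiff 𝓘(ℝ, E) 𝓘(ℝ, ℂ) ∞ f := hf
    have hg' : ContMDiff 𝓘(ℝ, E) 𝓘(ℝ, ℂ) ∞ g := hg
    exact hf'.add hg'
  algebraMap_mem' _ := contMDiff_const

/-- `C^∞(M)`. -/
abbrev SmoothFn : Type _ := smoothAlgebra E M

variable {M}

/-- The algebra `C^∞(C)` of smooth complex functions on a subset `C` of `M`: functions on `C`
that extend, near every point of `C`, to a smooth function on a neighbourhood in `M`. For an
embedded submanifold `C` these are the smooth functions for the submanifold structure. -/
def smoothAlgebraOn (C : Set M) : Subalgebra ℂ (C → ℂ) where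
  carrier := {g | ∀ x : C, ∃ V ∈ 𝓝 (x : M), ∃ G : M → ℂ,
    ContMDiffOn 𝓘(ℝ, E) 𝓘(ℝ, ℂ) ∞ G V ∧ ∀ y : C, (y : M) ∈ V → g y = G y}
  mul_mem' {f g} hf hg x := by
    obtain ⟨V, hV, F, hF, hFe⟩ := hf x
    obtain ⟨W, hW, G, hG, hGe⟩ := hg x
    exact ⟨V ∩ W, Filter.inter_mem hV hW, F * G,
      (contDiff_mul (𝕜 := ℝ) (𝔸 := ℂ)).contMDiff.comp_contMDiffOn
        ((hF.mono Set.inter_subset_left).prodMk_space (hG.mono Set.inter_subset_right)),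
      fun y hy => by simp [hFe y hy.1, hGe y hy.2]⟩
  add_mem' {f g} hf hg x := by
    obtain ⟨V, hV, F, hF, hFe⟩ := hf x
    obtain ⟨W, hW, G, hG, hGe⟩ := hg x
    exact ⟨V ∩ W, Filter.inter_mem hV hW, F + G,
      (hF.mono Set.inter_subset_left).add (hG.mono Set.inter_subset_right),
      fun y hy => by simp [hFe y hy.1, hGe y hy.2]⟩
  algebraMap_mem' r _ :=
    ⟨Set.univ, Filter.univ_mem, fun _ => r, contMDiffOn_const, fun _ _ => rfl⟩

/-- `C^∞(C)`. -/
abbrev SmoothFnOn (C : Set M) : Type _ := smoothAlgebraOn E C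

/-- The restriction `i^* : C^∞(M) → C^∞(C)`. -/
def restrict (C : Set M) : SmoothFn E M →ₐ[ℂ] SmoothFnOn E C where
  toFun f := ⟨fun x => f.1 x, fun _ =>
    ⟨Set.univ, Filter.univ_mem, f.1, contMDiffOn_univ.2 f.2, fun _ _ => rfl⟩⟩
  map_one' := rfl
  map_mul' _ _ := rfl
  map_zero' := rfl
  map_add' _ _ := rfl
  commutes' _ := rfl

/-- The restriction `i^*` on formal power series of functions. -/
def restrictSeries (C : Set M) : (SmoothFn E M)⟦X⟧ →ₗ[ℂ⟦X⟧] (SmoothFnOn E C)⟦X⟧ :=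
  mapSeries (restrict E C)

/-- A real valued smooth function, regarded as an element of `C^∞(M)`. -/
def ofReal (J : C^∞⟮𝓘(ℝ, E), M; ℝ⟯) : SmoothFn E M :=
  ⟨fun x => (J x : ℂ), by
    have h : ContMDiff 𝓘(ℝ, ℝ) 𝓘(ℝ, ℂ) ∞ Complex.ofRealCLM := Complex.ofRealCLM.contMDiff
    exact h.comp J.contMDiff⟩

end Smooth

/-! ### Symplectic geometry -/

section Symplectic

variable (E : Type*) [NormedAddCommGroup E] [NormedSpace ℝ E]
  (M : Type*) [TopologicalSpace M] [ChartedSpace E M]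

/-- The expression of a `2`-form in the chart `e`, a `2`-form on the target of `e`. -/
def chartForm {E : Type*} [NormedAddCommGroup E] [NormedSpace ℝ E]
    {M : Type*} [TopologicalSpace M] [ChartedSpace E M]
    (Ω : ∀ x : M, TangentSpace 𝓘(ℝ, E) x [⋀^Fin 2]→L[ℝ] ℝ) (e : OpenPartialHomeomorph M E)
    (y : E) : E [⋀^Fin 2]→L[ℝ] ℝ :=
  (Ω (e.symm y)).compContinuousLinearMap
    (show E →L[ℝ] TangentSpace 𝓘(ℝ, E) (e.symm y) from mfderiv 𝓘(ℝ, E) 𝓘(ℝ, E) e.symm y)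

/-- A symplectic form on `M`: a smooth, closed, nondegenerate `2`-form. -/
structure SymplecticForm where
  form : ∀ x : M, TangentSpace 𝓘(ℝ, E) x [⋀^Fin 2]→L[ℝ] ℝ
  smooth : ∀ e ∈ atlas E M, ContDiffOn ℝ ∞ (chartForm form e) e.target
  closed : ∀ e ∈ atlas E M, ∀ y ∈ e.target, extDeriv (chartForm form e) y = 0
  nondegenerate : ∀ (x : M) (v : TangentSpace 𝓘(ℝ, E) x), (∀ w, form x ![v, w] = 0) → v = 0

variable {E M}

open Classical in
/-- The Hamiltonian vector field `X_f` of a real function: `Ω(X_f, ·) = df`. -/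
def hamiltonianVectorField (Ω : SymplecticForm E M) (f : M → ℝ) (x : M) :
    TangentSpace 𝓘(ℝ, E) x :=
  if h : ∃ v : TangentSpace 𝓘(ℝ, E) x, ∀ w : TangentSpace 𝓘(ℝ, E) x,
      Ω.form x ![v, w] = mfderiv 𝓘(ℝ, E) 𝓘(ℝ, ℝ) f x w
  then h.choose else 0

/-- The differential of a complex valued function at a point. -/
def dC (f : M → ℂ) (x : M) (v : TangentSpace 𝓘(ℝ, E) x) : ℂ :=
  mfderiv 𝓘(ℝ, E) 𝓘(ℝ, ℂ) f x v

/-- The Poisson bracket `{f, g} = Ω(X_f, X_g) = df(X_g)`, extended `ℂ`-bilinearly to complex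
valued functions. -/
def poisson (Ω : SymplecticForm E M) (f g : SmoothFn E M) : M → ℂ := fun x =>
  dC f.1 x (hamiltonianVectorField Ω (fun y => (g.1 y).re) x) +
    Complex.I * dC f.1 x (hamiltonianVectorField Ω (fun y => (g.1 y).im) x)

theorem SmoothFn.mdifferentiableAt (f : SmoothFn E M) (x : M) :
    MDifferentiableAt 𝓘(ℝ, E) 𝓘(ℝ, ℂ) f.1 x :=
  (show ContMDiff 𝓘(ℝ, E) 𝓘(ℝ, ℂ) ∞ f.1 from f.2).mdifferentiableAt (by simp)

theorem dC_add (f g : SmoothFn E M) (x : M) (v : TangentSpace 𝓘(ℝ, E) x) :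
    dC (f + g).1 x v = dC f.1 x v + dC g.1 x v := by
  have h := ((f.mdifferentiableAt x).hasMFDerivAt.add (g.mdifferentiableAt x).hasMFDerivAt).mfderiv
  exact congrArg (fun L : E →L[ℝ] ℂ => L v) h

theorem dC_smul (a : ℂ) (f : SmoothFn E M) (x : M) (v : TangentSpace 𝓘(ℝ, E) x) :
    dC (a • f).1 x v = a * dC f.1 x v := by
  have h1 : HasMFDerivAt 𝓘(ℝ, ℂ) 𝓘(ℝ, ℂ) (a • ContinuousLinearMap.id ℝ ℂ) (f.1 x)
      (a • ContinuousLinearMap.id ℝ ℂ) :=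
    ContinuousLinearMap.hasMFDerivAt _
  have h := (h1.comp x (f.mdifferentiableAt x).hasMFDerivAt).mfderiv
  exact congrArg (fun L : E →L[ℝ] ℂ => L v) h

theorem poisson_add_left (Ω : SymplecticForm E M) (f g h : SmoothFn E M) :
    poisson Ω (f + g) h = poisson Ω f h + poisson Ω g h := by
  funext x
  simp only [poisson, Pi.add_apply, dC_add]
  ring

theorem poisson_smul_left (Ω : SymplecticForm E M) (a : ℂ) (f h : SmoothFn E M) :
    poisson Ω (a • f) h = a • poisson Ω f h := by
  funext x
  simp only [poisson, Pi.smul_apply, dC_smul, smul_eq_mul]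
  ring

/-- The Poisson bracket of formal power series. -/
def poissonSeries (Ω : SymplecticForm E M) (f g : (SmoothFn E M)⟦X⟧) : (M → ℂ)⟦X⟧ :=
  convolve (poisson Ω) f g

/-- `Φ`, on the domain `D ⊆ ℝ × M`, is the (maximal) flow of the vector field `v`; the point
reached from `x` at time `t` is `Φ (t, x)`. -/
structure IsFlow (v : ∀ x : M, TangentSpace 𝓘(ℝ, E) x) (D : Set (ℝ × M)) (Φ : ℝ × M → M) :
    Prop where
  isOpen_domain : IsOpen D
  contMDiffOn : ContMDiffOn (𝓘(ℝ, ℝ).prod 𝓘(ℝ, E)) 𝓘(ℝ, E) ∞ Φ D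
  zero_mem : ∀ x, ((0 : ℝ), x) ∈ D
  map_zero : ∀ x, Φ (0, x) = x
  ordConnected : ∀ x, {t : ℝ | (t, x) ∈ D}.OrdConnected
  isIntegralCurve : ∀ x, IsMIntegralCurveOn (fun t => Φ (t, x)) v {t : ℝ | (t, x) ∈ D}
  maximal : ∀ (x : M) (γ : ℝ → M) (s : Set ℝ), IsOpen s → s.OrdConnected → (0 : ℝ) ∈ s →
    γ 0 = x → IsMIntegralCurveOn γ v s → ∀ t ∈ s, (t, x) ∈ D

end Symplectic

/-! ### Star products, and the classical and deformed algebras of a constraint -/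

section Star

variable {E : Type*} [NormedAddCommGroup E] [NormedSpace ℝ E]
  {M : Type*} [TopologicalSpace M] [ChartedSpace E M]

/-- A (local) star product on the symplectic manifold `(M, Ω)`:
`f * g = ∑ λ^n M_n(f, g)`, associative, with unit `1`, deforming the pointwise product in the
direction of the Poisson bracket, and not enlarging supports. -/
structure StarProduct (Ω : SymplecticForm E M) where
  op : ℕ → SmoothFn E M →ₗ[ℂ] SmoothFn E M →ₗ[ℂ] SmoothFn E M
  op_zero : ∀ f g, op 0 f g = f * g
  op_one_comm : ∀ f g, ((op 1 f g - op 1 g f : SmoothFn E M) : M → ℂ) = Complex.I • poisson Ω f g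
  op_unit_right : ∀ n, 1 ≤ n → ∀ f, op n f 1 = 0
  op_unit_left : ∀ n, 1 ≤ n → ∀ f, op n 1 f = 0
  assoc : ∀ n f g h, ∑ p ∈ Finset.HasAntidiagonal.antidiagonal n, op p.1 (op p.2 f g) h =
    ∑ p ∈ Finset.HasAntidiagonal.antidiagonal n, op p.1 f (op p.2 g h)
  isLocal : ∀ n (f g : SmoothFn E M),
    tsupport (op n f g : M → ℂ) ⊆ tsupport (f : M → ℂ) ∩ tsupport (g : M → ℂ)

namespace StarProduct

variable {Ω : SymplecticForm E M} (star : StarProduct Ω)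

/-- `M_k` on formal power series. -/
def opSeries (k : ℕ) (f g : (SmoothFn E M)⟦X⟧) : (SmoothFn E M)⟦X⟧ :=
  convolve (fun a b => star.op k a b) f g

/-- `M_k(f, g) - M_k(g, f)`. -/
def antisymm (k : ℕ) (f g : (SmoothFn E M)⟦X⟧) : (SmoothFn E M)⟦X⟧ :=
  star.opSeries k f g - star.opSeries k g f

/-- The star product `f * g = ∑ λ^k M_k(f, g)` of formal power series. -/
def mul (f g : (SmoothFn E M)⟦X⟧) : (SmoothFn E M)⟦X⟧ :=
  formalSum fun k => star.opSeries k f g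

theorem add_mul (f f' g : (SmoothFn E M)⟦X⟧) :
    star.mul (f + f') g = star.mul f g + star.mul f' g := by
  unfold mul
  rw [← formalSum_add]
  congr 1
  funext k
  exact convolve_add_left (fun u v w => by simp) f f' g

theorem mul_add (f g g' : (SmoothFn E M)⟦X⟧) :
    star.mul f (g + g') = star.mul f g + star.mul f g' := by
  unfold mul
  rw [← formalSum_add]
  congr 1
  funext k
  exact convolve_add_right (fun u v w => by simp) f g g'

theorem smul_mul (c : ℂ⟦X⟧) (f g : (SmoothFn E M)⟦X⟧) :
    star.mul (c • f) g = c • star.mul f g := by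
  unfold mul
  rw [← formalSum_smul]
  congr 1
  funext k
  exact convolve_smul_left (fun u v w => by simp) (fun a u w => by simp) c f g

theorem mul_smul (c : ℂ⟦X⟧) (f g : (SmoothFn E M)⟦X⟧) :
    star.mul f (c • g) = c • star.mul f g := by
  unfold mul
  rw [← formalSum_smul]
  congr 1
  funext k
  exact convolve_smul_right (fun u v w => by simp) (fun a u w => by simp) c f g

end StarProduct

/-- The constraint surface `C = J⁻¹(0)`. -/
def constraintSurface (J : C^∞⟮𝓘(ℝ, E), M; ℝ⟯) : Set M := {x | J x = 0}

/-- The constraint function as a (constant) formal power series. -/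
def constraintSeries (J : C^∞⟮𝓘(ℝ, E), M; ℝ⟯) : (SmoothFn E M)⟦X⟧ := PowerSeries.C (ofReal E J)

/-- The classical vanishing ideal `I = {f | i^* f = 0}`, in formal power series. -/
def vanishingIdeal (J : C^∞⟮𝓘(ℝ, E), M; ℝ⟯) : Submodule ℂ⟦X⟧ (SmoothFn E M)⟦X⟧ :=
  LinearMap.ker (restrictSeries E (constraintSurface J))

/-- Restriction to `C` of formal power series of arbitrary functions on `M`. -/
def restrictFun (C : Set M) : (M → ℂ)⟦X⟧ →ₗ[ℂ⟦X⟧] (C → ℂ)⟦X⟧ :=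
  mapSeries
    { toFun := fun f x => f x
      map_one' := rfl
      map_mul' := fun _ _ => rfl
      map_zero' := rfl
      map_add' := fun _ _ => rfl
      commutes' := fun _ => rfl }

/-- The classical algebra `B = {f | {f, g} ∈ I for all g ∈ I}`, in formal power series; membership
in `I` is spelled out as vanishing on `C`. -/
def classicalB (Ω : SymplecticForm E M) (J : C^∞⟮𝓘(ℝ, E), M; ℝ⟯) :
    Submodule ℂ⟦X⟧ (SmoothFn E M)⟦X⟧ where
  carrier := {f | ∀ g ∈ vanishingIdeal J,
    restrictFun (constraintSurface J) (poissonSeries Ω f g) = 0}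
  add_mem' {f f'} hf hf' g hg := by
    have h : poissonSeries Ω (f + f') g = poissonSeries Ω f g + poissonSeries Ω f' g :=
      convolve_add_left (poisson_add_left Ω) f f' g
    rw [h, map_add, hf g hg, hf' g hg, add_zero]
  zero_mem' g _ := by
    have h : poissonSeries Ω ((0 : ℂ⟦X⟧) • (0 : (SmoothFn E M)⟦X⟧)) g = (0 : ℂ⟦X⟧) • _ :=
      convolve_smul_left (poisson_add_left Ω) (poisson_smul_left Ω) 0 0 g
    rw [zero_smul, zero_smul] at h
    rw [h, map_zero]
  smul_mem' c f hf g hg := by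
    have h : poissonSeries Ω (c • f) g = c • poissonSeries Ω f g :=
      convolve_smul_left (poisson_add_left Ω) (poisson_smul_left Ω) c f g
    rw [h, map_smul, hf g hg, smul_zero]

variable {Ω : SymplecticForm E M}

/-- The star left ideal `I^* = {g * J}`. -/
def starIdeal (star : StarProduct Ω) (J : C^∞⟮𝓘(ℝ, E), M; ℝ⟯) :
    Submodule ℂ⟦X⟧ (SmoothFn E M)⟦X⟧ where
  carrier := {f | ∃ g, f = star.mul g (constraintSeries J)}
  add_mem' := by
    rintro _ _ ⟨g, rfl⟩ ⟨g', rfl⟩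
    exact ⟨g + g', (star.add_mul _ _ _).symm⟩
  zero_mem' := ⟨(0 : ℂ⟦X⟧) • 0, by rw [star.smul_mul, zero_smul]⟩
  smul_mem' := by
    rintro c _ ⟨g, rfl⟩
    exact ⟨c • g, (star.smul_mul _ _ _).symm⟩

/-- The deformed algebra `B^* = {f | f * g - g * f ∈ I^* for all g ∈ I^*}`. -/
def starB (star : StarProduct Ω) (J : C^∞⟮𝓘(ℝ, E), M; ℝ⟯) :
    Submodule ℂ⟦X⟧ (SmoothFn E M)⟦X⟧ where
  carrier := {f | ∀ g ∈ starIdeal star J, star.mul f g - star.mul g f ∈ starIdeal star J}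
  add_mem' {f f'} hf hf' g hg := by
    rw [star.add_mul, star.mul_add, add_sub_add_comm]
    exact add_mem (hf g hg) (hf' g hg)
  zero_mem' g _ := by
    have h1 := star.smul_mul 0 0 g
    have h2 := star.mul_smul 0 g 0
    rw [zero_smul, zero_smul] at h1 h2
    rw [h1, h2, sub_zero]
    exact zero_mem _
  smul_mem' c f hf g hg := by
    have h : star.mul (c • f) g - star.mul g (c • f) = c • (star.mul f g - star.mul g f) := by
      rw [star.smul_mul, star.mul_smul]
      exact (_root_.smul_sub c (star.mul f g) (star.mul g f)).symm
    rw [h]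
    exact Submodule.smul_mem _ c (hf g hg)

/-- A prolongation prescription `p : C^∞(C)⟦λ⟧ → C^∞(M)⟦λ⟧` with `i^* ∘ p = id`. -/
structure Prolongation (J : C^∞⟮𝓘(ℝ, E), M; ℝ⟯) where
  extend : (SmoothFnOn E (constraintSurface J))⟦X⟧ →ₗ[ℂ⟦X⟧] (SmoothFn E M)⟦X⟧
  restrict_extend : ∀ g, restrictSeries E (constraintSurface J) (extend g) = g

namespace Prolongation

variable {J : C^∞⟮𝓘(ℝ, E), M; ℝ⟯} (p : Prolongation J)

/-- `prol(f) = p(i^* f)`. -/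
def prol : (SmoothFn E M)⟦X⟧ →ₗ[ℂ⟦X⟧] (SmoothFn E M)⟦X⟧ :=
  p.extend ∘ₗ restrictSeries E (constraintSurface J)

/-- The space `F = {f | prol f = f}` of pure prolongations. -/
def pure : Submodule ℂ⟦X⟧ (SmoothFn E M)⟦X⟧ := LinearMap.eqLocus LinearMap.id p.prol

open Classical in
/-- The component of `f` along `J`: the series `h` with `f - prol f = h · J`. -/
def component (f : (SmoothFn E M)⟦X⟧) : (SmoothFn E M)⟦X⟧ :=
  if h : ∃ q : (SmoothFn E M)⟦X⟧, f - p.prol f = q * constraintSeries J then h.choose else 0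

end Prolongation

variable {J : C^∞⟮𝓘(ℝ, E), M; ℝ⟯}

/-- The operators `T_0 = id`, `T_n(f) = - ∑_{k=1}^{n} T_{n-k}(M_k(pr_J f, J))`; here `n` is
written `m + 1` and `k` is written `j + 1`. -/
def opT (star : StarProduct Ω) (p : Prolongation J) :
    ℕ → (SmoothFn E M)⟦X⟧ → (SmoothFn E M)⟦X⟧
  | 0, f => f
  | m + 1, f => - ∑ j : Fin (m + 1),
      opT star p (m - j) (star.opSeries (j + 1) (p.component f) (constraintSeries J))
  termination_by n => n

/-- `F_n[S_0, …, S_{n-2}; T_0, …, T_{n-1}](f) = ∑_{k=2}^{n} M⁻_k(J, S_{n-k} f)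
+ ∑_{i=1}^{n-1} ∑_{k=1}^{n-i} T_i(M⁻_k(J, S_{n-k-i} f))`, with
`M⁻_k(f, g) = M_k(f, g) - M_k(g, f)`. -/
def opF (star : StarProduct Ω) (J : C^∞⟮𝓘(ℝ, E), M; ℝ⟯)
    (S T : ℕ → (SmoothFn E M)⟦X⟧ → (SmoothFn E M)⟦X⟧) (n : ℕ) (f : (SmoothFn E M)⟦X⟧) :
    (SmoothFn E M)⟦X⟧ :=
  ∑ k ∈ Finset.Icc 2 n, star.antisymm k (constraintSeries J) (S (n - k) f) +
    ∑ i ∈ Finset.Icc 1 (n - 1), ∑ k ∈ Finset.Icc 1 (n - i),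
      T i (star.antisymm k (constraintSeries J) (S (n - k - i) f))

/-- `σ` is a (global) transversal section of the foliation of `C = J⁻¹(0)` by the orbits of the
Hamiltonian flow `Φ` (with domain `D`): an embedded hypersurface of `C`, transversal to `X_J`, such
that every `p ∈ C` is `Φ_t(s)` for a unique time `t = t(p)` and a unique `s = 𝔭(p) ∈ σ`. -/
structure IsTransversalSection (Ω : SymplecticForm E M) (J : C^∞⟮𝓘(ℝ, E), M; ℝ⟯)
    (D : Set (ℝ × M)) (Φ : ℝ × M → M) (σ : Set M) : Prop where
  subset : σ ⊆ constraintSurface J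
  transversal : ∀ s ∈ σ, ∃ W ∈ 𝓝 s, ∃ u : M → ℝ, ContMDiffOn 𝓘(ℝ, E) 𝓘(ℝ, ℝ) ∞ u W ∧
    (∀ x ∈ W, x ∈ σ ↔ x ∈ constraintSurface J ∧ u x = 0) ∧
    (mfderiv 𝓘(ℝ, E) 𝓘(ℝ, ℝ) u s (hamiltonianVectorField Ω J s) : ℝ) ≠ 0
  existsUnique : ∀ x ∈ constraintSurface J, ∃! q : ℝ × M, q ∈ D ∧ q.2 ∈ σ ∧ Φ q = x

/-- The recursion for the operators `S_n`. The second field is the coefficientwise formula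
`(S_n f)(x) = -i ∫_0^t (Φ_τ^* F_{n+1}[S; T](f))(s) dτ` at `x = Φ_t(s) ∈ C`, `s ∈ σ`; the third
says that `S_n f` is the prolongation of its restriction to `C`. -/
structure IsRecursionS (star : StarProduct Ω) (p : Prolongation J)
    (D : Set (ℝ × M)) (Φ : ℝ × M → M) (σ : Set M)
    (S : ℕ → (SmoothFn E M)⟦X⟧ → (SmoothFn E M)⟦X⟧) : Prop where
  zero : ∀ f, S 0 f = f
  onSurface : ∀ n, 1 ≤ n → ∀ f, ∀ s ∈ σ, ∀ t : ℝ, (t, s) ∈ D → ∀ m : ℕ,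
    (PowerSeries.coeff m (S n f) : SmoothFn E M).1 (Φ (t, s)) =
      -Complex.I * ∫ τ in (0 : ℝ)..t,
        (PowerSeries.coeff m (opF star J S (opT star p) (n + 1) f) : SmoothFn E M).1 (Φ (τ, s))
  prolonged : ∀ n, 1 ≤ n → ∀ f, S n f = p.prol (S n f)

end Star

end StarReduction

end

open scoped Manifold ContDiff Topology PowerSeries
open StarReduction

/-! ### Smooth calculus -/

section Calculus

variable {E F : Type*} [NormedAddCommGroup E] [NormedSpace ℝ E]
  [NormedAddCommGroup F] [NormedSpace ℝ F]

/-! Put `T = ∑ λ^n T_n` and `A g = prol(g) + pr_J(g) * J`. Since `prol(g) + pr_J(g) J = g`, the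
operator `A` is the identity plus higher orders in `λ`, and the recursion for `T_n` says exactly
that `T A = id`. As `T` starts with the identity it is injective, so `A T = id` as well. Hence `f ∈
I^*` if and only if `T f` vanishes on `C` (`mem_starIdeal_iff`): `I^*` is straightened to `I`.

Because `I^*` is the left ideal generated by `J`, membership of `f` in `B^*` only has to be tested
on `J` (`mem_starB_iff`). So `S f ∈ B^*` means that `T(J * S f - S f * J)` vanishes on `C`. Its term
of index `n + 1` is `M⁻_1(J, S_n f) + F_{n+1}(f)`, where `M⁻_1(J, g) = -i X_J g`. The integral
formula for `S_n` is the solution of `X_J(S_n f) = -i F_{n+1}(f)` on `C` that vanishes on `σ`, so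
all terms with `n ≥ 1` cancel there and only `-i λ X_J f` is left (`restrictSeries_commutator`). By
division by `J`, `X_J f = 0` on `C` is the condition `f ∈ B` (`mem_classicalB_iff`). Thus `S f ∈
B^*` if and only if `f ∈ B`, for every `f`. Finally `S` is invertible, since `S_0 = id`, and both
`S` and its inverse preserve `F`.

The analytic input is Hadamard division by `J` (`exists_quotient`), which makes `pr_J` well defined,
and smoothness on `C` of the orbit integrals (`orbitIntegral_mem`). The latter combines the implicit
function theorem for the transit time with differentiation under the integral sign. -/

theorem hasFDerivAt_integral_of_contDiffOn [FiniteDimensional ℝ E] {U : Set (E × ℝ)} {V : Set E}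
    {G : E × ℝ → F} (hU : IsOpen U) (hV : IsOpen V) (hG : ContDiffOn ℝ ∞ G U)
    (hVU : ∀ y ∈ V, ∀ s ∈ Set.Icc (0 : ℝ) 1, (y, s) ∈ U) {y₀ : E} (hy₀ : y₀ ∈ V) :
    HasFDerivAt (fun y => ∫ s in (0 : ℝ)..1, G (y, s))
      (∫ s in (0 : ℝ)..1, (fderiv ℝ G (y₀, s)).comp (ContinuousLinearMap.inl ℝ E ℝ)) y₀ := by
  have : ProperSpace E := FiniteDimensional.proper_real E
  obtain ⟨ε, hε, hball⟩ := Metric.nhds_basis_closedBall.mem_iff.1 (hV.mem_nhds hy₀)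
  have hG' : ContinuousOn (fun q => (fderiv ℝ G q).comp (ContinuousLinearMap.inl ℝ E ℝ)) U :=
    (hG.continuousOn_fderiv_of_isOpen hU (by simp)).clm_comp continuousOn_const
  -- Finite dimension makes this set compact, which yields a constant dominating bound for the
  -- derivative.
  have hK : IsCompact (Metric.closedBall y₀ ε ×ˢ Set.Icc (0 : ℝ) 1) :=
    (isCompact_closedBall y₀ ε).prod isCompact_Icc
  have hKU : Metric.closedBall y₀ ε ×ˢ Set.Icc (0 : ℝ) 1 ⊆ U :=
    fun q hq => hVU q.1 (hball hq.1) q.2 hq.2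
  obtain ⟨B, hB⟩ := hK.exists_bound_of_continuousOn (hG'.mono hKU)
  have hI : Set.uIoc (0 : ℝ) 1 ⊆ Set.Icc 0 1 := by
    rw [Set.uIoc_of_le zero_le_one]; exact Set.Ioc_subset_Icc_self
  have hmeas : ∀ y ∈ V, MeasureTheory.AEStronglyMeasurable (fun s => G (y, s))
      (MeasureTheory.volume.restrict (Set.uIoc (0 : ℝ) 1)) := fun y hy =>
    (((hG.continuousOn.comp (by fun_prop) (fun s hs => hVU y hy s hs) :
      ContinuousOn (fun s => G (y, s)) (Set.Icc (0 : ℝ) 1))).mono hI).aestronglyMeasurable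
        measurableSet_uIoc
  refine intervalIntegral.hasFDerivAt_integral_of_dominated_of_fderiv_le
    (F := fun y s => G (y, s))
    (F' := fun y s => (fderiv ℝ G (y, s)).comp (ContinuousLinearMap.inl ℝ E ℝ))
    (bound := fun _ => B) (Metric.ball_mem_nhds y₀ hε) ?_ ?_ ?_ ?_ ?_ ?_
  · filter_upwards [hV.mem_nhds hy₀] with y hy using hmeas y hy
  · refine ContinuousOn.intervalIntegrable ?_
    rw [Set.uIcc_of_le zero_le_one]
    exact hG.continuousOn.comp (by fun_prop) (fun s hs => hVU y₀ hy₀ s hs)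
  · exact ((hG'.comp (by fun_prop) (fun s hs => hVU y₀ hy₀ s hs) :
      ContinuousOn (fun s : ℝ => (fderiv ℝ G (y₀, s)).comp (ContinuousLinearMap.inl ℝ E ℝ))
        (Set.Icc (0 : ℝ) 1)).mono hI).aestronglyMeasurable measurableSet_uIoc
  · exact Filter.Eventually.of_forall fun s hs y hy =>
      hB (y, s) ⟨Metric.ball_subset_closedBall hy, hI hs⟩
  · exact intervalIntegrable_const
  · refine Filter.Eventually.of_forall fun s hs y hy => ?_
    have hq : (y, s) ∈ U := hKU ⟨Metric.ball_subset_closedBall hy, hI hs⟩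
    have h1 : HasFDerivAt G (fderiv ℝ G (y, s)) (y, s) :=
      ((hG.contDiffAt (hU.mem_nhds hq)).differentiableAt (by simp)).hasFDerivAt
    exact h1.comp y (hasFDerivAt_prodMk_left y s)

/-- Induction on the order, with `G` varying: evaluated at a fixed `v`, the derivative is an
integral of the same kind with integrand `fderiv ℝ G q (v, 0)`. In finite dimension such evaluations
detect smoothness. -/
theorem contDiffOn_integral_of_contDiffOn [FiniteDimensional ℝ E] [CompleteSpace F]
    {U : Set (E × ℝ)} {V : Set E}
    {G : E × ℝ → F} (hU : IsOpen U) (hV : IsOpen V) (hG : ContDiffOn ℝ ∞ G U)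
    (hVU : ∀ y ∈ V, ∀ s ∈ Set.Icc (0 : ℝ) 1, (y, s) ∈ U) :
    ContDiffOn ℝ ∞ (fun y => ∫ s in (0 : ℝ)..1, G (y, s)) V := by
  refine contDiffOn_infty.2 fun n => ?_
  induction n generalizing G with
  | zero =>
    exact contDiffOn_zero.2 fun y hy =>
      (hasFDerivAt_integral_of_contDiffOn hU hV hG hVU hy).continuousAt.continuousWithinAt
  | succ n ih =>
    have hder : ∀ y ∈ V, HasFDerivAt (fun y => ∫ s in (0 : ℝ)..1, G (y, s)) _ y :=
      fun y hy => hasFDerivAt_integral_of_contDiffOn hU hV hG hVU hy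
    push_cast
    rw [contDiffOn_succ_iff_fderiv_of_isOpen hV]
    refine ⟨fun y hy => (hder y hy).differentiableAt.differentiableWithinAt, by simp, ?_⟩
    rw [contDiffOn_clm_apply]
    intro v
    have hG'v : ContDiffOn ℝ ∞ (fun q => fderiv ℝ G q (v, 0)) U :=
      (hG.fderiv_of_isOpen hU (by simp)).clm_apply contDiffOn_const
    refine (ih hG'v).congr fun y hy => ?_
    rw [(hder y hy).fderiv, ContinuousLinearMap.intervalIntegral_apply]
    · simp
    · refine ContinuousOn.intervalIntegrable ?_
      rw [Set.uIcc_of_le zero_le_one]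
      have hG' : ContinuousOn (fun q => (fderiv ℝ G q).comp (ContinuousLinearMap.inl ℝ E ℝ)) U :=
        (hG.continuousOn_fderiv_of_isOpen hU (by simp)).clm_comp continuousOn_const
      exact hG'.comp (by fun_prop) (fun s hs => hVU y hy s hs)

/-- A smooth scalar implicit function theorem on a neighbourhood. -/
theorem exists_smooth_implicit [CompleteSpace E] {U : Set (E × ℝ)} {u : E × ℝ → ℝ} {y₀ : E} {t₀ : ℝ}
    (hU : IsOpen U) (hu : ContDiffOn ℝ ∞ u U) (h₀ : (y₀, t₀) ∈ U) (hz : u (y₀, t₀) = 0)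
    (hd : fderiv ℝ u (y₀, t₀) (0, 1) ≠ 0) :
    ∃ V : Set E, IsOpen V ∧ y₀ ∈ V ∧ ∃ τ : E → ℝ, ContDiffOn ℝ ∞ τ V ∧ τ y₀ = t₀ ∧
      ∀ y ∈ V, (y, τ y) ∈ U ∧ u (y, τ y) = 0 := by
  have hinv : ∀ q : E × ℝ, fderiv ℝ u q (0, 1) ≠ 0 →
      (fderiv ℝ u q ∘L .inr ℝ E ℝ).IsInvertible := fun q hq => by
    refine ⟨ContinuousLinearEquiv.smulLeft (Units.mk0 _ hq), ?_⟩
    ext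
    simp
  have hu0 : ContDiffAt ℝ ∞ u (y₀, t₀) := hu.contDiffAt (hU.mem_nhds h₀)
  set τ := hu0.implicitFunction (by simp) (hinv _ hd) with hτ
  have hτ0 : τ y₀ = t₀ := hu0.implicitFunction_apply_self (by simp) (hinv _ hd)
  have hτs : ContDiffAt ℝ ∞ τ y₀ := hu0.contDiffAt_implicitFunction (by simp) (hinv _ hd)
  have hτ1 : ∀ᶠ y in 𝓝 y₀, ContDiffAt ℝ 1 τ y := (hτs.of_le (by simp)).eventually (by simp)
  have hcont : Filter.Tendsto (fun y => (y, τ y)) (𝓝 y₀) (𝓝 (y₀, t₀)) := by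
    have := (continuousAt_id (x := y₀)).prodMk hτs.continuousAt
    simpa [ContinuousAt, hτ0] using this
  have hdU : ∀ᶠ q in 𝓝 (y₀, t₀), fderiv ℝ u q (0, 1) ≠ 0 := by
    have : ContinuousOn (fun q => fderiv ℝ u q (0, 1)) U :=
      (hu.continuousOn_fderiv_of_isOpen hU (by simp)).clm_apply continuousOn_const
    exact (this.continuousAt (hU.mem_nhds h₀)).eventually_ne hd
  have hev : ∀ᶠ y in 𝓝 y₀, ContDiffAt ℝ 1 τ y ∧ (y, τ y) ∈ U ∧ fderiv ℝ u (y, τ y) (0, 1) ≠ 0 ∧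
      u (y, τ y) = 0 := by
    filter_upwards [hτ1, hcont.eventually (hU.mem_nhds h₀), hcont.eventually hdU,
      hu0.eventually_apply_implicitFunction (by simp) (hinv _ hd)] with y h1 h2 h3 h4
    exact ⟨h1, h2, h3, h4.trans hz⟩
  obtain ⟨V, hVsub, hVo, hyV⟩ := eventually_nhds_iff.1 hev
  refine ⟨V, hVo, hyV, τ, fun y hy => ?_, hτ0, fun y hy => ⟨(hVsub y hy).2.1, (hVsub y hy).2.2.2⟩⟩
  obtain ⟨h1, h2, h3, h4⟩ := hVsub y hy
  -- Smoothness of `τ` at the single point `y₀` gives no common neighbourhood for all orders. At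
  -- each nearby `y` the theorem is applied afresh at `(y, τ y)`; local uniqueness identifies the
  -- new implicit function with `τ` near `y`.
  have huy : ContDiffAt ℝ ∞ u (y, τ y) := hu.contDiffAt (hU.mem_nhds h2)
  have hψ := huy.contDiffAt_implicitFunction (by simp) (hinv _ h3)
  refine ContDiffAt.contDiffWithinAt (hψ.congr_of_eventuallyEq ?_)
  have hc : Filter.Tendsto (fun y => (y, τ y)) (𝓝 y) (𝓝 (y, τ y)) :=
    (continuousAt_id (x := y)).prodMk h1.continuousAt
  filter_upwards [hc.eventually (huy.eventually_apply_eq_iff_implicitFunction (by simp) (hinv _ h3)),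
    hVo.mem_nhds hy] with z hz hzV
  exact (hz.1 ((hVsub z hzV).2.2.2.trans h4.symm)).symm

/-- Division with remainder of the increment of a function along the direction `v`. -/
theorem exists_smooth_increment [FiniteDimensional ℝ E] [CompleteSpace F]
    {B V : Set E} {f : E → F} {τ : E → ℝ} (v : E) (hB : IsOpen B) (hBc : Convex ℝ B)
    (hV : IsOpen V) (hVB : V ⊆ B) (hf : ContDiffOn ℝ ∞ f B) (hτ : ContDiffOn ℝ ∞ τ V)
    (hmem : ∀ y ∈ V, y + τ y • v ∈ B) :
    ∃ k : E → F, ContDiffOn ℝ ∞ k V ∧ (∀ y ∈ V, f (y + τ y • v) - f y = τ y • k y) ∧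
      ∀ y ∈ V, τ y = 0 → k y = fderiv ℝ f y v := by
  have hγ : ContDiffOn ℝ ∞ (fun q : E × ℝ => q.1 + (q.2 * τ q.1) • v) (V ×ˢ Set.univ) := by
    have h1 : ContDiffOn ℝ ∞ (fun q : E × ℝ => τ q.1) (V ×ˢ Set.univ) :=
      hτ.comp contDiffOn_fst (fun q hq => hq.1)
    exact contDiffOn_fst.add ((contDiffOn_snd.mul h1).smul contDiffOn_const)
  have hU : IsOpen ((V ×ˢ Set.univ) ∩ (fun q : E × ℝ => q.1 + (q.2 * τ q.1) • v) ⁻¹' B) :=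
    hγ.continuousOn.isOpen_inter_preimage (hV.prod isOpen_univ) hB
  have hseg : ∀ y ∈ V, ∀ s ∈ Set.Icc (0 : ℝ) 1, y + (s * τ y) • v ∈ B := fun y hy s hs => by
    have := hBc.add_smul_sub_mem (hVB hy) (hmem y hy) hs
    simpa [mul_smul] using this
  have hG : ContDiffOn ℝ ∞ (fun q : E × ℝ => fderiv ℝ f (q.1 + (q.2 * τ q.1) • v) v)
      ((V ×ˢ Set.univ) ∩ (fun q : E × ℝ => q.1 + (q.2 * τ q.1) • v) ⁻¹' B) :=
    ((hf.fderiv_of_isOpen hB (by simp)).comp (hγ.mono Set.inter_subset_left)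
      (fun q hq => hq.2)).clm_apply contDiffOn_const
  -- The witness is the mean of the derivative along `v` over the segment from `y` to `y + τ y • v`.
  -- Parametrising by `[0, 1]` extracts the factor `τ y` and keeps `k` meaningful where `τ y = 0`.
  refine ⟨fun y => ∫ s in (0 : ℝ)..1, fderiv ℝ f (y + (s * τ y) • v) v,
    contDiffOn_integral_of_contDiffOn hU hV hG (fun y hy s hs => ⟨⟨hy, trivial⟩, hseg y hy s hs⟩),
    fun y hy => ?_, fun y hy h0 => by simp [h0]⟩
  have hder : ∀ s ∈ Set.uIcc (0 : ℝ) 1, HasDerivAt (fun s : ℝ => f (y + (s * τ y) • v))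
      (τ y • fderiv ℝ f (y + (s * τ y) • v) v) s := fun s hs => by
    rw [Set.uIcc_of_le zero_le_one] at hs
    have h1 : HasFDerivAt f (fderiv ℝ f (y + (s * τ y) • v)) (y + (s * τ y) • v) :=
      ((hf.contDiffAt (hB.mem_nhds (hseg y hy s hs))).differentiableAt (by simp)).hasFDerivAt
    have h2 : HasDerivAt (fun s : ℝ => y + (s * τ y) • v) (τ y • v) s := by
      simpa using (((hasDerivAt_id s).mul_const (τ y)).smul_const v).const_add y
    simpa [Function.comp_def] using h1.comp_hasDerivAt s h2
  have hint : IntervalIntegrable (fun s : ℝ => τ y • fderiv ℝ f (y + (s * τ y) • v) v)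
      MeasureTheory.volume 0 1 := by
    refine ContinuousOn.intervalIntegrable ?_
    rw [Set.uIcc_of_le zero_le_one]
    exact continuousOn_const.smul (hG.continuousOn.comp (f := fun s : ℝ => (y, s)) (by fun_prop)
      (fun s hs => ⟨⟨hy, trivial⟩, hseg y hy s hs⟩))
  have := intervalIntegral.integral_eq_sub_of_hasDerivAt hder hint
  rw [intervalIntegral.integral_smul] at this
  simpa using this.symm

/-- Hadamard's lemma: a smooth function vanishing on a regular level set `j = 0` is, locally, a
smooth multiple of `j`. -/
theorem exists_smooth_local_quotient [FiniteDimensional ℝ E] [CompleteSpace F]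
    {V₀ : Set E} {f : E → F} {j : E → ℝ} {y₀ : E} (hV₀ : IsOpen V₀) (hy₀ : y₀ ∈ V₀)
    (hf : ContDiffOn ℝ ∞ f V₀) (hj : ContDiffOn ℝ ∞ j V₀) (hj₀ : j y₀ = 0)
    (hdj : fderiv ℝ j y₀ ≠ 0) (hz : ∀ y ∈ V₀, j y = 0 → f y = 0) :
    ∃ V : Set E, IsOpen V ∧ y₀ ∈ V ∧ ∃ h : E → F, ContDiffOn ℝ ∞ h V ∧
      ∀ y ∈ V, f y = j y • h y := by
  have : CompleteSpace E := FiniteDimensional.complete ℝ E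
  obtain ⟨v, hv⟩ : ∃ v, fderiv ℝ j y₀ v ≠ 0 := by
    by_contra! h
    exact hdj (ContinuousLinearMap.ext h)
  obtain ⟨ε, hε, hball⟩ := Metric.isOpen_iff.1 hV₀ y₀ hy₀
  set B := Metric.ball y₀ ε with hBdef
  have hB : IsOpen B := Metric.isOpen_ball
  have hy₀B : y₀ ∈ B := Metric.mem_ball_self hε
  have hBc : Convex ℝ B := convex_ball y₀ ε
  have hγ : ContDiff ℝ ∞ (fun q : E × ℝ => q.1 + q.2 • v) :=
    contDiff_fst.add (contDiff_snd.smul contDiff_const)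
  have hdu : fderiv ℝ (fun q : E × ℝ => j (q.1 + q.2 • v)) (y₀, 0) (0, 1) = fderiv ℝ j y₀ v := by
    have h1 : HasFDerivAt j (fderiv ℝ j y₀) ((fun q : E × ℝ => q.1 + q.2 • v) (y₀, 0)) := by
      simpa using ((hj.contDiffAt (hV₀.mem_nhds hy₀)).differentiableAt (by simp)).hasFDerivAt
    have h2 : HasFDerivAt (fun q : E × ℝ => q.1 + q.2 • v)
        (ContinuousLinearMap.fst ℝ E ℝ + (ContinuousLinearMap.snd ℝ E ℝ).smulRight v) (y₀, 0) :=
      hasFDerivAt_fst.add (hasFDerivAt_snd.smul_const v)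
    have h3 := (h1.comp (y₀, (0 : ℝ)) h2).fderiv
    have h4 := congrArg (fun L : E × ℝ →L[ℝ] ℝ => L (0, 1)) h3
    simpa [Function.comp_def] using h4
  -- `τ y` is the displacement along `v` that carries `y` onto the level set `j = 0`.
  obtain ⟨V₁, hV₁, hyV₁, τ, hτ, hτ0, hτz⟩ := exists_smooth_implicit
    (U := (fun q : E × ℝ => q.1 + q.2 • v) ⁻¹' B) (u := fun q => j (q.1 + q.2 • v))
    (y₀ := y₀) (t₀ := 0) (hB.preimage hγ.continuous)
    ((hj.mono hball).comp hγ.contDiffOn (fun q hq => hq)) (by simpa using hy₀B) (by simpa using hj₀)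
    (by rw [hdu]; exact hv)
  have hVo : IsOpen (V₁ ∩ B) := hV₁.inter hB
  obtain ⟨kf, hkf, hkfe, -⟩ := exists_smooth_increment v hB hBc hVo Set.inter_subset_right
    (hf.mono hball) (hτ.mono Set.inter_subset_left) (fun y hy => (hτz y hy.1).1)
  obtain ⟨kj, hkj, hkje, hkj0⟩ := exists_smooth_increment v hB hBc hVo Set.inter_subset_right
    (hj.mono hball) (hτ.mono Set.inter_subset_left) (fun y hy => (hτz y hy.1).1)
  have hkj0' : kj y₀ ≠ 0 := by rw [hkj0 y₀ ⟨hyV₁, hy₀B⟩ hτ0]; exact hv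
  refine ⟨(V₁ ∩ B) ∩ kj ⁻¹' {0}ᶜ, hkj.continuousOn.isOpen_inter_preimage hVo isOpen_compl_singleton,
    ⟨⟨hyV₁, hy₀B⟩, hkj0'⟩, fun y => (kj y)⁻¹ • kf y,
    ((hkj.mono Set.inter_subset_left).inv (fun y hy => hy.2)).smul (hkf.mono Set.inter_subset_left),
    fun y hy => ?_⟩
  -- Both `f` and `j` vanish at `y + τ y • v`, so `-f = τ kf` and `-j = τ kj`; the quotient is
  -- therefore `kf / kj`.
  have h1 := hkfe y hy.1
  have h2 := hkje y hy.1
  have h3 := hτz y hy.1.1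
  have hne : kj y ≠ 0 := hy.2
  rw [h3.2, zero_sub] at h2
  rw [hz _ (hball h3.1) h3.2, zero_sub] at h1
  rw [← neg_inj, h1, ← neg_smul, h2, smul_smul, smul_eq_mul, mul_assoc, mul_inv_cancel₀ hne,
    mul_one]

end Calculus

namespace StarReduction

/-! ### Linear operators on formal power series -/

section FormalOperators

set_option linter.unusedSectionVars false

variable {R N : Type*} [CommRing R] [Algebra ℂ R] [CommRing N] [Algebra ℂ N]

theorem coeff_zero_X_smul (f : R⟦X⟧) : PowerSeries.coeff 0 ((PowerSeries.X : ℂ⟦X⟧) • f) = 0 := by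
  simp [coeff_formal_smul]

theorem coeff_succ_X_smul (n : ℕ) (f : R⟦X⟧) :
    PowerSeries.coeff (n + 1) ((PowerSeries.X : ℂ⟦X⟧) • f) = PowerSeries.coeff n f := by
  rw [coeff_formal_smul, Finset.sum_eq_single (1, n)]
  · simp
  · rintro ⟨a, b⟩ h hne
    rw [Finset.HasAntidiagonal.mem_antidiagonal] at h
    have : a ≠ 1 := fun h1 => hne (Prod.ext h1 (by dsimp only at *; omega))
    simp [PowerSeries.coeff_X, this]
  · intro h
    exact absurd (Finset.HasAntidiagonal.mem_antidiagonal.2 (by simp [add_comm])) h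

theorem coeff_X_pow_smul_of_lt {m n : ℕ} (h : m < n) (f : R⟦X⟧) :
    PowerSeries.coeff m ((PowerSeries.X ^ n : ℂ⟦X⟧) • f) = 0 := by
  induction n generalizing m with
  | zero => omega
  | succ n ih =>
    rw [pow_succ', mul_smul]
    cases m with
    | zero => exact coeff_zero_X_smul _
    | succ m => rw [coeff_succ_X_smul, ih (by omega)]

theorem X_smul_injective : Function.Injective fun f : R⟦X⟧ => (PowerSeries.X : ℂ⟦X⟧) • f := by
  intro f g h
  ext n
  rw [← coeff_succ_X_smul n f, ← coeff_succ_X_smul n g]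
  exact congrArg (PowerSeries.coeff (n + 1)) h

theorem formalSum_eq_add_X_smul (G : ℕ → R⟦X⟧) :
    formalSum G = G 0 + (PowerSeries.X : ℂ⟦X⟧) • formalSum fun k => G (k + 1) := by
  ext n
  cases n with
  | zero => rw [map_add, coeff_zero_X_smul]; simp [formalSum]
  | succ n =>
    rw [map_add, coeff_succ_X_smul]
    simp [formalSum, Finset.Nat.antidiagonal_succ]

theorem exists_formalSum_eq_sum_add (G : ℕ → R⟦X⟧) (n : ℕ) :
    ∃ r, formalSum G = ∑ k ∈ Finset.range n, (PowerSeries.X ^ k : ℂ⟦X⟧) • G k +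
      (PowerSeries.X ^ n : ℂ⟦X⟧) • r := by
  suffices h : formalSum G = ∑ k ∈ Finset.range n, (PowerSeries.X ^ k : ℂ⟦X⟧) • G k +
      (PowerSeries.X ^ n : ℂ⟦X⟧) • formalSum fun k => G (k + n) from ⟨_, h⟩
  induction n with
  | zero => simp
  | succ n ih =>
    rw [ih, Finset.sum_range_succ, formalSum_eq_add_X_smul fun k => G (k + n), smul_add, smul_smul,
      ← pow_succ, zero_add, add_assoc]
    simp only [add_assoc, add_comm 1 n]

/-- Linearity over `ℂ⟦λ⟧` forces `λ`-adic continuity: modulo `λ^(m+1)` the formal sum is a finite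
combination, and the image of the remainder keeps its factor `λ^(m+1)`. Hence no continuity is
required of the prolongation. -/
theorem map_formalSum (L : R⟦X⟧ →ₗ[ℂ⟦X⟧] N⟦X⟧) (G : ℕ → R⟦X⟧) :
    L (formalSum G) = formalSum fun k => L (G k) := by
  ext m
  obtain ⟨r, hr⟩ := exists_formalSum_eq_sum_add G (m + 1)
  obtain ⟨r', hr'⟩ := exists_formalSum_eq_sum_add (fun k => L (G k)) (m + 1)
  rw [hr, hr', map_add, map_add, map_add, map_sum, map_smul,
    coeff_X_pow_smul_of_lt (Nat.lt_succ_self m), coeff_X_pow_smul_of_lt (Nat.lt_succ_self m)]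
  simp only [map_smul]

theorem formalSum_formalSum (G : ℕ → ℕ → R⟦X⟧) :
    (formalSum fun i => formalSum fun j => G i j) =
      formalSum fun n => ∑ q ∈ Finset.HasAntidiagonal.antidiagonal n, G q.1 q.2 := by
  ext n
  simp only [formalSum, PowerSeries.coeff_mk, map_sum]
  exact (sum_antidiagonal_assoc n fun i j k => PowerSeries.coeff k (G i j)).symm

theorem formalSum_C_coeff (f : R⟦X⟧) :
    (formalSum fun k => PowerSeries.C (PowerSeries.coeff k f)) = f := by
  ext n
  rw [formalSum, PowerSeries.coeff_mk, Finset.sum_eq_single (n, 0)]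
  · simp
  · rintro ⟨a, b⟩ h hne
    rw [Finset.HasAntidiagonal.mem_antidiagonal] at h
    have : b ≠ 0 := fun h1 => hne (Prod.ext (by dsimp only at *; omega) h1)
    simp [PowerSeries.coeff_C, this]
  · intro h
    exact absurd (Finset.HasAntidiagonal.mem_antidiagonal.2 (by simp)) h

/-- Every series is the formal sum of its constant coefficients, so operator identities need only be
checked on constants. -/
theorem linearMap_ext_C {L L' : R⟦X⟧ →ₗ[ℂ⟦X⟧] N⟦X⟧}
    (h : ∀ a, L (PowerSeries.C a) = L' (PowerSeries.C a)) : L = L' := by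
  refine LinearMap.ext fun f => ?_
  rw [← formalSum_C_coeff f, map_formalSum, map_formalSum]
  simp only [h]

theorem formalSum_zero : formalSum (fun _ => (0 : R⟦X⟧)) = 0 := by
  ext n
  simp [formalSum]

/-- The operator `∑ λ^n S_n`. -/
noncomputable def formalSumMap (S : ℕ → R⟦X⟧ →ₗ[ℂ⟦X⟧] R⟦X⟧) : R⟦X⟧ →ₗ[ℂ⟦X⟧] R⟦X⟧ where
  toFun f := formalSum fun n => S n f
  map_add' f g := by simp only [map_add, formalSum_add]
  map_smul' c f := by simp only [map_smul, formalSum_smul, RingHom.id_apply]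

theorem formalSumMap_apply (S : ℕ → R⟦X⟧ →ₗ[ℂ⟦X⟧] R⟦X⟧) (f : R⟦X⟧) :
    formalSumMap S f = formalSum fun n => S n f := rfl

/-- Modulo `λ` the operator is the identity, so an element of the kernel has the form `λ f'`.
Cancelling `λ` puts `f'` in the kernel too, and the argument repeats. -/
theorem formalSumMap_injective {S : ℕ → R⟦X⟧ →ₗ[ℂ⟦X⟧] R⟦X⟧} (h0 : ∀ f, S 0 f = f) :
    Function.Injective (formalSumMap S) := by
  rw [injective_iff_map_eq_zero]
  intro f hf
  ext n
  induction n generalizing f with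
  | zero =>
    have := congrArg (PowerSeries.coeff 0) hf
    rw [formalSumMap_apply, formalSum_eq_add_X_smul, map_add, coeff_zero_X_smul, h0] at this
    simpa using this
  | succ n ih =>
    have h := congrArg (PowerSeries.coeff 0) hf
    rw [formalSumMap_apply, formalSum_eq_add_X_smul, map_add, coeff_zero_X_smul, h0] at h
    have hg : f = (PowerSeries.X : ℂ⟦X⟧) • PowerSeries.mk fun n => PowerSeries.coeff (n + 1) f := by
      ext m
      cases m with
      | zero => rw [coeff_zero_X_smul]; simpa using h
      | succ m => rw [coeff_succ_X_smul]; simp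
    rw [hg, map_smul] at hf
    have h0' := X_smul_injective (hf.trans (smul_zero (PowerSeries.X : ℂ⟦X⟧)).symm)
    rw [hg, coeff_succ_X_smul, ih _ h0']
    simp

/-- The coefficients of the inverse of `∑ λ^n S_n` with `S_0 = id`. -/
noncomputable def inverseCoeff (S : ℕ → R⟦X⟧ →ₗ[ℂ⟦X⟧] R⟦X⟧) (h : R⟦X⟧) : ℕ → R⟦X⟧
  | 0 => h
  | n + 1 => - ∑ k : Fin (n + 1), S (k + 1) (inverseCoeff S h (n - k))
  termination_by n => n

/-- The recursion for `g_n = inverseCoeff S h n` says that `∑_{i+j=n} S_i(g_j) = 0` for every `n ≥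
1`; only `g_0 = h` survives. -/
theorem formalSumMap_inverseCoeff {S : ℕ → R⟦X⟧ →ₗ[ℂ⟦X⟧] R⟦X⟧} (h0 : ∀ f, S 0 f = f) (h : R⟦X⟧) :
    formalSumMap S (formalSum (inverseCoeff S h)) = h := by
  rw [formalSumMap_apply]
  simp only [map_formalSum]
  rw [formalSum_formalSum, formalSum_eq_add_X_smul]
  have : ∀ n, ∑ q ∈ Finset.HasAntidiagonal.antidiagonal (n + 1), S q.1 (inverseCoeff S h q.2) = 0 := by
    intro n
    rw [Finset.Nat.antidiagonal_succ, Finset.sum_cons, Finset.sum_map, h0, inverseCoeff,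
      Finset.Nat.sum_antidiagonal_eq_sum_range_succ_mk, ← Fin.sum_univ_eq_sum_range]
    exact neg_add_cancel _
  simp only [this, formalSum_zero]
  simp [h0, inverseCoeff]

theorem inverseCoeff_mem {S : ℕ → R⟦X⟧ →ₗ[ℂ⟦X⟧] R⟦X⟧} {F : Submodule ℂ⟦X⟧ R⟦X⟧}
    (hS : ∀ n, ∀ f ∈ F, S n f ∈ F) {h : R⟦X⟧} (hh : h ∈ F) (n : ℕ) : inverseCoeff S h n ∈ F := by
  induction n using Nat.strong_induction_on with
  | _ n ih =>
    cases n with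
    | zero => rwa [inverseCoeff]
    | succ n =>
      rw [inverseCoeff]
      exact neg_mem (sum_mem fun k _ => hS _ _ (ih _ (by omega)))

theorem formalSum_mem_eqLocus {L : R⟦X⟧ →ₗ[ℂ⟦X⟧] R⟦X⟧} {G : ℕ → R⟦X⟧}
    (hG : ∀ k, L (G k) = G k) : L (formalSum G) = formalSum G := by
  rw [map_formalSum]
  simp only [hG]

/-- The coefficientwise extension of a `ℂ`-linear map. -/
noncomputable def mapCoeff (k : R →ₗ[ℂ] N) : R⟦X⟧ →ₗ[ℂ⟦X⟧] N⟦X⟧ where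
  toFun f := PowerSeries.mk fun n => k (PowerSeries.coeff n f)
  map_add' f g := by ext; simp
  map_smul' c f := by ext; simp [coeff_formal_smul]

theorem coeff_mapCoeff (k : R →ₗ[ℂ] N) (f : R⟦X⟧) (n : ℕ) :
    PowerSeries.coeff n (mapCoeff k f) = k (PowerSeries.coeff n f) := by
  simp [mapCoeff]

end FormalOperators

/-! ### The star product on formal power series -/

section StarSeries

variable {E : Type*} [NormedAddCommGroup E] [NormedSpace ℝ E]
  {M : Type*} [TopologicalSpace M] [ChartedSpace E M] {Ω : SymplecticForm E M}

namespace StarProduct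

variable (star : StarProduct Ω)

/-- `M_k` as a bilinear map. -/
noncomputable def opMap (k : ℕ) :
    (SmoothFn E M)⟦X⟧ →ₗ[ℂ⟦X⟧] (SmoothFn E M)⟦X⟧ →ₗ[ℂ⟦X⟧] (SmoothFn E M)⟦X⟧ :=
  LinearMap.mk₂ ℂ⟦X⟧ (star.opSeries k)
    (convolve_add_left fun u v w => by simp)
    (convolve_smul_left (fun u v w => by simp) (fun a u w => by simp))
    (convolve_add_right fun u v w => by simp)
    (fun c f g => convolve_smul_right (fun u v w => by simp) (fun a u w => by simp) c f g)

theorem opMap_apply (k : ℕ) (f g : (SmoothFn E M)⟦X⟧) :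
    star.opMap k f g = star.opSeries k f g := rfl

/-- The star product as a bilinear map. -/
noncomputable def mulMap :
    (SmoothFn E M)⟦X⟧ →ₗ[ℂ⟦X⟧] (SmoothFn E M)⟦X⟧ →ₗ[ℂ⟦X⟧] (SmoothFn E M)⟦X⟧ :=
  LinearMap.mk₂ ℂ⟦X⟧ star.mul star.add_mul star.smul_mul star.mul_add
    (fun c f g => star.mul_smul c f g)

theorem mulMap_apply (f g : (SmoothFn E M)⟦X⟧) : star.mulMap f g = star.mul f g := rfl

theorem opSeries_C_C (k : ℕ) (a b : SmoothFn E M) :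
    star.opSeries k (PowerSeries.C a) (PowerSeries.C b) = PowerSeries.C (star.op k a b) := by
  refine PowerSeries.ext fun n => ?_
  rw [opSeries, convolve, PowerSeries.coeff_mk, PowerSeries.coeff_C]
  split_ifs with h
  · subst h; simp
  · refine (Finset.sum_eq_zero fun q hq => ?_)
    rw [Finset.HasAntidiagonal.mem_antidiagonal] at hq
    rcases Nat.eq_zero_or_pos q.1 with h1 | h1
    · have : q.2 ≠ 0 := by omega
      simp [PowerSeries.coeff_C, this]
    · simp [PowerSeries.coeff_C, h1.ne']

theorem mul_C_C (a b : SmoothFn E M) :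
    star.mul (PowerSeries.C a) (PowerSeries.C b) =
      formalSum fun k => PowerSeries.C (star.op k a b) := by
  simp only [mul, opSeries_C_C]

theorem mul_formalSum_left (G : ℕ → (SmoothFn E M)⟦X⟧) (g : (SmoothFn E M)⟦X⟧) :
    star.mul (formalSum G) g = formalSum fun k => star.mul (G k) g :=
  map_formalSum (star.mulMap.flip g) G

theorem mul_formalSum_right (G : ℕ → (SmoothFn E M)⟦X⟧) (f : (SmoothFn E M)⟦X⟧) :
    star.mul f (formalSum G) = formalSum fun k => star.mul f (G k) :=
  map_formalSum (star.mulMap f) G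

theorem mul_assoc (f g h : (SmoothFn E M)⟦X⟧) :
    star.mul (star.mul f g) h = star.mul f (star.mul g h) := by
  have hC : ∀ a b c : SmoothFn E M,
      star.mul (star.mul (PowerSeries.C a) (PowerSeries.C b)) (PowerSeries.C c) =
        star.mul (PowerSeries.C a) (star.mul (PowerSeries.C b) (PowerSeries.C c)) := by
    intro a b c
    rw [mul_C_C, mul_C_C, mul_formalSum_left, mul_formalSum_right]
    simp only [mul_C_C]
    rw [formalSum_formalSum, formalSum_formalSum]
    congr 1
    funext n
    -- Merging the double sums lists the inner operation first, whereas `star.assoc` lists the outer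
    -- one first.
    rw [← map_sum, ← map_sum, ← Finset.Nat.sum_antidiagonal_swap,
      ← Finset.Nat.sum_antidiagonal_swap (f := fun x => star.op x.2 a (star.op x.1 b c))]
    exact congrArg _ (star.assoc n a b c)
  have h1 : ∀ a b, star.mulMap (star.mul (PowerSeries.C a) (PowerSeries.C b)) =
      star.mulMap (PowerSeries.C a) ∘ₗ star.mulMap (PowerSeries.C b) := fun a b =>
    linearMap_ext_C fun c => hC a b c
  have h2 : ∀ a, (star.mulMap.flip h) ∘ₗ star.mulMap (PowerSeries.C a) =
      star.mulMap (PowerSeries.C a) ∘ₗ star.mulMap.flip h := fun a =>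
    linearMap_ext_C fun b => LinearMap.congr_fun (h1 a b) h
  have h3 : (star.mulMap.flip h) ∘ₗ (star.mulMap.flip g) = star.mulMap.flip (star.mul g h) :=
    linearMap_ext_C fun a => LinearMap.congr_fun (h2 a) g
  exact LinearMap.congr_fun h3 f

theorem one_mul (f : (SmoothFn E M)⟦X⟧) : star.mul 1 f = f := by
  have h : star.mulMap 1 = LinearMap.id := linearMap_ext_C fun a => by
    rw [mulMap_apply, ← map_one PowerSeries.C, mul_C_C, formalSum_eq_add_X_smul]
    simp [star.op_unit_left, star.op_zero, formalSum_zero]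
  exact LinearMap.congr_fun h f

end StarProduct

end StarSeries

end StarReduction

namespace StarReduction

/-! ### Hamiltonian vector fields and the Poisson bracket on the constraint surface -/

section Hamiltonian

variable {E : Type*} [NormedAddCommGroup E] [NormedSpace ℝ E]
  {M : Type*} [TopologicalSpace M] [ChartedSpace E M] (Ω : SymplecticForm E M)

/-- The differential of a real valued function at a point. -/
noncomputable def dR (f : M → ℝ) (x : M) (v : TangentSpace 𝓘(ℝ, E) x) : ℝ :=
  mfderiv 𝓘(ℝ, E) 𝓘(ℝ, ℝ) f x v

theorem SymplecticForm.form_swap (x : M) (v w : TangentSpace 𝓘(ℝ, E) x) :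
    Ω.form x ![v, w] = - Ω.form x ![w, v] := by
  have h := (Ω.form x).toAlternatingMap.map_swap ![w, v] (i := 0) (j := 1) (by decide)
  have h2 : (![w, v] ∘ Equiv.swap (0 : Fin 2) 1) = ![v, w] := by
    funext i
    fin_cases i <;> simp
  rw [h2] at h
  exact h

theorem SymplecticForm.form_add (x : M) (v v' w : TangentSpace 𝓘(ℝ, E) x) :
    Ω.form x ![v + v', w] = Ω.form x ![v, w] + Ω.form x ![v', w] :=
  (Ω.form x).toContinuousMultilinearMap.cons_add ![w] v v'

theorem SymplecticForm.form_smul (x : M) (c : ℝ) (v w : TangentSpace 𝓘(ℝ, E) x) :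
    Ω.form x ![c • v, w] = c * Ω.form x ![v, w] :=
  (Ω.form x).toContinuousMultilinearMap.cons_smul ![w] c v

/-- A symplectic form at a point, as a bilinear map. -/
noncomputable def SymplecticForm.bilin (x : M) :
    TangentSpace 𝓘(ℝ, E) x →ₗ[ℝ] TangentSpace 𝓘(ℝ, E) x →ₗ[ℝ] ℝ :=
  LinearMap.mk₂ ℝ (fun v w => Ω.form x ![v, w]) (Ω.form_add x) (Ω.form_smul x)
    (fun v w w' => by
      rw [Ω.form_swap x v, Ω.form_add, Ω.form_swap x v w, Ω.form_swap x v w']; ring)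
    (fun c v w => by
      rw [Ω.form_swap x v, Ω.form_smul, Ω.form_swap x v w, smul_eq_mul]; ring)

theorem SymplecticForm.bilin_apply (x : M) (v w : TangentSpace 𝓘(ℝ, E) x) :
    Ω.bilin x v w = Ω.form x ![v, w] := rfl

theorem SymplecticForm.bilin_injective (x : M) : Function.Injective (Ω.bilin x) := by
  rw [injective_iff_map_eq_zero]
  intro v hv
  exact Ω.nondegenerate x v fun w => LinearMap.congr_fun hv w

/-- Nondegeneracy and equality of dimensions make `v ↦ Ω(v, ·)` bijective onto the dual, so the
default value `0` in the definition of `X_f` never occurs. -/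
theorem form_hamiltonianVectorField [FiniteDimensional ℝ E] (f : M → ℝ) (x : M)
    (w : TangentSpace 𝓘(ℝ, E) x) :
    Ω.form x ![hamiltonianVectorField Ω f x, w] = dR f x w := by
  have hfd : FiniteDimensional ℝ (TangentSpace 𝓘(ℝ, E) x) := inferInstanceAs (FiniteDimensional ℝ E)
  have hsurj : Function.Surjective (Ω.bilin x) :=
    (LinearMap.injective_iff_surjective_of_finrank_eq_finrank
      (Subspace.dual_finrank_eq (K := ℝ) (V := TangentSpace 𝓘(ℝ, E) x)).symm).1 (Ω.bilin_injective x)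
  have h : ∃ v : TangentSpace 𝓘(ℝ, E) x, ∀ w : TangentSpace 𝓘(ℝ, E) x,
      Ω.form x ![v, w] = mfderiv 𝓘(ℝ, E) 𝓘(ℝ, ℝ) f x w := by
    obtain ⟨v, hv⟩ := hsurj (mfderiv 𝓘(ℝ, E) 𝓘(ℝ, ℝ) f x).toLinearMap
    exact ⟨v, fun w => LinearMap.congr_fun hv w⟩
  rw [hamiltonianVectorField, dif_pos h]
  exact h.choose_spec w

theorem hamiltonianVectorField_eq_of_form [FiniteDimensional ℝ E] {f : M → ℝ} {x : M}
    {v : TangentSpace 𝓘(ℝ, E) x}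
    (h : ∀ w, Ω.form x ![v, w] = dR f x w) :
    hamiltonianVectorField Ω f x = v :=
  Ω.bilin_injective x <| LinearMap.ext fun w => by
    rw [Ω.bilin_apply, Ω.bilin_apply, form_hamiltonianVectorField, h]

theorem dR_hamiltonianVectorField_self [FiniteDimensional ℝ E] (f : M → ℝ) (x : M) :
    dR f x (hamiltonianVectorField Ω f x) = 0 := by
  rw [← form_hamiltonianVectorField]
  exact (Ω.form x).map_eq_zero_of_eq _ (i := 0) (j := 1) rfl (by decide)

theorem hasMFDerivAt_clm_comp {f : SmoothFn E M} (L : ℂ →L[ℝ] ℝ) (x : M) :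
    HasMFDerivAt 𝓘(ℝ, E) 𝓘(ℝ, ℝ) (fun y => L (f.1 y)) x
      (L.comp (mfderiv 𝓘(ℝ, E) 𝓘(ℝ, ℂ) f.1 x)) :=
  (L.hasMFDerivAt (x := f.1 x)).comp x (f.mdifferentiableAt x).hasMFDerivAt

theorem dR_re (f : SmoothFn E M) (x : M) (v : TangentSpace 𝓘(ℝ, E) x) :
    dR (fun y => (f.1 y).re) x v = (dC f.1 x v).re :=
  congrArg (fun L : E →L[ℝ] ℝ => L v) (hasMFDerivAt_clm_comp (f := f) Complex.reCLM x).mfderiv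

theorem dR_im (f : SmoothFn E M) (x : M) (v : TangentSpace 𝓘(ℝ, E) x) :
    dR (fun y => (f.1 y).im) x v = (dC f.1 x v).im :=
  congrArg (fun L : E →L[ℝ] ℝ => L v) (hasMFDerivAt_clm_comp (f := f) Complex.imCLM x).mfderiv

theorem mdifferentiableAt_real (J : C^∞⟮𝓘(ℝ, E), M; ℝ⟯) (x : M) :
    MDifferentiableAt 𝓘(ℝ, E) 𝓘(ℝ, ℝ) J x :=
  J.contMDiff.mdifferentiableAt (by simp)

theorem dC_ofReal (J : C^∞⟮𝓘(ℝ, E), M; ℝ⟯) (x : M) (v : TangentSpace 𝓘(ℝ, E) x) :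
    dC (ofReal E J).1 x v = (dR J x v : ℂ) :=
  congrArg (fun L : E →L[ℝ] ℂ => L v)
    ((Complex.ofRealCLM.hasMFDerivAt (x := J x)).comp x
      (mdifferentiableAt_real J x).hasMFDerivAt).mfderiv

variable [FiniteDimensional ℝ E] (J : C^∞⟮𝓘(ℝ, E), M; ℝ⟯)

theorem poisson_ofReal_left (f : SmoothFn E M) (x : M) :
    poisson Ω (ofReal E J) f x = - dC f.1 x (hamiltonianVectorField Ω J x) := by
  have h : ∀ g : M → ℝ, dR J x (hamiltonianVectorField Ω g x) =
      - dR g x (hamiltonianVectorField Ω J x) := fun g => by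
    rw [← form_hamiltonianVectorField Ω J, ← form_hamiltonianVectorField Ω g, Ω.form_swap]
  rw [poisson, dC_ofReal, dC_ofReal, h, h, dR_re, dR_im]
  push_cast
  conv_rhs => rw [← Complex.re_add_im (dC f.1 x (hamiltonianVectorField Ω J x))]
  ring

variable {J}

theorem hamiltonianVectorField_mul {a : M → ℝ} {x : M}
    (ha : MDifferentiableAt 𝓘(ℝ, E) 𝓘(ℝ, ℝ) a x) (hx : x ∈ constraintSurface J) :
    hamiltonianVectorField Ω (fun y => a y * J y) x = a x • hamiltonianVectorField Ω J x := by
  refine hamiltonianVectorField_eq_of_form Ω fun w => ?_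
  have h := (ha.hasMFDerivAt.mul (mdifferentiableAt_real J x).hasMFDerivAt).mfderiv
  have h' : dR (fun y => a y * J y) x w = a x * dR J x w + J x * dR a x w :=
    congrArg (fun L : E →L[ℝ] ℝ => L w) h
  have hx' : J x = 0 := hx
  rw [Ω.form_smul, form_hamiltonianVectorField, h', hx', zero_mul, add_zero]

/-- On `C` one has `d(aJ) = a dJ`, hence `X_{aJ} = a X_J`; this is applied to the real and imaginary
parts of `q`. It turns brackets with elements of `I` into derivatives along `X_J`. -/
theorem poisson_mul_ofReal (f q : SmoothFn E M) {x : M} (hx : x ∈ constraintSurface J) :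
    poisson Ω f (q * ofReal E J) x = q.1 x * dC f.1 x (hamiltonianVectorField Ω J x) := by
  have hre : (fun y => ((q * ofReal E J).1 y).re) = fun y => (q.1 y).re * J y := by
    funext y
    exact Complex.re_mul_ofReal _ _
  have him : (fun y => ((q * ofReal E J).1 y).im) = fun y => (q.1 y).im * J y := by
    funext y
    exact Complex.im_mul_ofReal _ _
  have hlin : ∀ (c : ℝ) (v : TangentSpace 𝓘(ℝ, E) x), dC f.1 x (c • v) = c * dC f.1 x v :=
    fun c v => (map_smul (mfderiv 𝓘(ℝ, E) 𝓘(ℝ, ℂ) f.1 x) c v).trans (Complex.real_smul)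
  rw [poisson, hre, him,
    hamiltonianVectorField_mul Ω (a := fun y => (q.1 y).re)
      (hasMFDerivAt_clm_comp Complex.reCLM x).mdifferentiableAt hx,
    hamiltonianVectorField_mul Ω (a := fun y => (q.1 y).im)
      (hasMFDerivAt_clm_comp Complex.imCLM x).mdifferentiableAt hx,
    hlin, hlin]
  conv_rhs => rw [← Complex.re_add_im (q.1 x)]
  ring

end Hamiltonian

/-! ### Division by the constraint function -/

section Division

variable {E : Type*} [NormedAddCommGroup E] [NormedSpace ℝ E]
  {M : Type*} [TopologicalSpace M] [ChartedSpace E M] {J : C^∞⟮𝓘(ℝ, E), M; ℝ⟯}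

/-- If `a x ≠ b x`, then `a ≠ b` near `x` by continuity, so `J` would vanish near `x`, against `dJ ≠
0`. -/
theorem eq_of_mul_eventuallyEq (hJ : ∀ x ∈ constraintSurface J, mfderiv 𝓘(ℝ, E) 𝓘(ℝ, ℝ) J x ≠ 0)
    {a b : M → ℂ} {x : M} (hx : x ∈ constraintSurface J) (ha : ContinuousAt a x)
    (hb : ContinuousAt b x) (h : ∀ᶠ y in 𝓝 x, (J y : ℂ) * a y = J y * b y) : a x = b x := by
  by_contra hne
  have h1 : ∀ᶠ y in 𝓝 x, a y ≠ b y :=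
    ((ha.sub hb).eventually_ne (sub_ne_zero.2 hne)).mono fun y hy => sub_ne_zero.1 hy
  have h2 : (J : M → ℝ) =ᶠ[𝓝 x] fun _ => (0 : ℝ) := by
    filter_upwards [h, h1] with y hy hy1
    by_contra hJy
    exact hy1 (mul_left_cancel₀ (Complex.ofReal_ne_zero.2 hJy) hy)
  exact hJ x hx (h2.mfderiv_eq.trans mfderiv_const)

theorem quotient_unique (hJ : ∀ x ∈ constraintSurface J, mfderiv 𝓘(ℝ, E) 𝓘(ℝ, ℝ) J x ≠ 0)
    {q q' : SmoothFn E M} (h : q * ofReal E J = q' * ofReal E J) : q = q' := by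
  have hy : ∀ y, (J y : ℂ) * q.1 y = J y * q'.1 y := fun y => by
    rw [mul_comm, mul_comm (J y : ℂ)]
    exact congrFun (congrArg Subtype.val h) y
  have hc : ∀ f : SmoothFn E M, Continuous f.1 := fun f =>
    (show ContMDiff 𝓘(ℝ, E) 𝓘(ℝ, ℂ) ∞ f.1 from f.2).continuous
  refine Subtype.ext (funext fun y => ?_)
  by_cases hyC : y ∈ constraintSurface J
  · exact eq_of_mul_eventuallyEq hJ hyC (hc q).continuousAt (hc q').continuousAt
      (Filter.Eventually.of_forall hy)
  · exact mul_left_cancel₀ (Complex.ofReal_ne_zero.2 hyC) (hy y)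

variable [FiniteDimensional ℝ E] [IsManifold 𝓘(ℝ, E) ∞ M]

theorem exists_contMDiffOn_local_quotient
    {x : M} (hx : x ∈ constraintSurface J) (hJ : mfderiv 𝓘(ℝ, E) 𝓘(ℝ, ℝ) J x ≠ 0)
    {f : SmoothFn E M} (hf : ∀ y ∈ constraintSurface J, f.1 y = 0) :
    ∃ V : Set M, IsOpen V ∧ x ∈ V ∧ ∃ h : M → ℂ, ContMDiffOn 𝓘(ℝ, E) 𝓘(ℝ, ℂ) ∞ h V ∧
      ∀ y ∈ V, f.1 y = J y * h y := by
  set e := chartAt E x with he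
  have hes : ContMDiffOn 𝓘(ℝ, E) 𝓘(ℝ, E) ∞ e.symm e.target := contMDiffOn_chart_symm
  have hxe : e.symm (e x) = x := e.left_inv (mem_chart_source E x)
  have hfs : ContMDiff 𝓘(ℝ, E) 𝓘(ℝ, ℂ) ∞ f.1 := f.2
  obtain ⟨V, hVo, hxV, h, hh, hfh⟩ := exists_smooth_local_quotient (V₀ := e.target)
    (f := fun y => f.1 (e.symm y)) (j := fun y => J (e.symm y)) (y₀ := e x) e.open_target
    (e.map_source (mem_chart_source E x)) (contMDiffOn_iff_contDiffOn.1 (hfs.comp_contMDiffOn hes))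
    (contMDiffOn_iff_contDiffOn.1 (J.contMDiff.comp_contMDiffOn hes)) (by rw [hxe]; exact hx)
    (fun h0 => hJ (by
      rw [(mdifferentiableAt_real J x).mfderiv]
      simp only [writtenInExtChartAt, extChartAt, mfld_simps, fderivWithin_univ]
      exact h0))
    (fun y hy hJy => hf _ hJy)
  refine ⟨e.source ∩ e ⁻¹' V, e.isOpen_inter_preimage hVo, ⟨mem_chart_source E x, hxV⟩,
    fun y => h (e y), ?_, fun y hy => ?_⟩
  · exact hh.contMDiffOn.comp (contMDiffOn_chart.mono Set.inter_subset_left) (fun y hy => hy.2)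
  · have := hfh (e y) hy.2
    simpa [e.left_inv hy.1] using this

/-- Local quotients are unique even at points of `C`, so they glue without a partition of unity; off
`C` the quotient is `f / J`. -/
theorem exists_quotient (hJ : ∀ x ∈ constraintSurface J, mfderiv 𝓘(ℝ, E) 𝓘(ℝ, ℝ) J x ≠ 0)
    {f : SmoothFn E M} (hf : ∀ y ∈ constraintSurface J, f.1 y = 0) :
    ∃ q : SmoothFn E M, f = q * ofReal E J := by
  classical
  choose V hVo hxV h hh hfh using fun x : constraintSurface J =>
    exists_contMDiffOn_local_quotient x.2 (hJ x x.2) hf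
  let q : M → ℂ := fun y => if hy : y ∈ constraintSurface J then h ⟨y, hy⟩ y else f.1 y / J y
  have hq : ∀ x : constraintSurface J, ∀ y ∈ V x, q y = h x y := by
    intro x y hy
    by_cases hyC : y ∈ constraintSurface J
    · simp only [q, dif_pos hyC]
      refine eq_of_mul_eventuallyEq hJ hyC
        ((hh ⟨y, hyC⟩).continuousOn.continuousAt ((hVo _).mem_nhds (hxV ⟨y, hyC⟩)))
        ((hh x).continuousOn.continuousAt ((hVo _).mem_nhds hy)) ?_
      filter_upwards [(hVo _).mem_nhds (hxV ⟨y, hyC⟩), (hVo _).mem_nhds hy] with z h1 h2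
      rw [← hfh _ z h1, ← hfh _ z h2]
    · simp only [q, dif_neg hyC]
      rw [hfh x y hy, mul_div_cancel_left₀]
      exact Complex.ofReal_ne_zero.2 hyC
  have hfs : ContMDiff 𝓘(ℝ, E) 𝓘(ℝ, ℂ) ∞ f.1 := f.2
  have hqs : ContMDiff 𝓘(ℝ, E) 𝓘(ℝ, ℂ) ∞ q := by
    intro y
    by_cases hyC : y ∈ constraintSurface J
    · refine ((hh ⟨y, hyC⟩).contMDiffAt ((hVo _).mem_nhds (hxV ⟨y, hyC⟩))).congr_of_eventuallyEq ?_
      filter_upwards [(hVo _).mem_nhds (hxV ⟨y, hyC⟩)] with z hz using hq _ z hz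
    · have hopen : IsOpen (constraintSurface J)ᶜ :=
        (isClosed_eq J.contMDiff.continuous continuous_const).isOpen_compl
      have hJs : ContMDiff 𝓘(ℝ, E) 𝓘(ℝ, ℂ) ∞ (ofReal E J).1 := (ofReal E J).2
      have hJy : (ofReal E J).1 y ≠ 0 := Complex.ofReal_ne_zero.2 hyC
      have hinv : ContMDiffAt 𝓘(ℝ, ℂ) 𝓘(ℝ, ℂ) ∞ (fun z : ℂ => z⁻¹) ((ofReal E J).1 y) :=
        (contDiffAt_inv ℝ hJy).contMDiffAt
      have hmul := ((contDiff_mul (𝕜 := ℝ) (𝔸 := ℂ) (n := ∞)).contMDiff).contMDiffAt.comp y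
        (ContMDiffAt.prodMk_space (hfs y) (hinv.comp y (hJs y)))
      refine hmul.congr_of_eventuallyEq ?_
      filter_upwards [hopen.mem_nhds hyC] with z hz
      simp only [q]
      rw [dif_neg hz]
      exact div_eq_mul_inv _ _
  refine ⟨⟨q, hqs⟩, Subtype.ext (funext fun y => ?_)⟩
  by_cases hyC : y ∈ constraintSurface J
  · have h0 : J y = 0 := hyC
    have : (ofReal E J).1 y = 0 := by simp [ofReal, h0]
    change f.1 y = q y * (ofReal E J).1 y
    rw [this, hf y hyC, mul_zero]
  · change f.1 y = q y * (J y : ℂ)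
    simp only [q]
    rw [dif_neg hyC, div_mul_cancel₀]
    exact Complex.ofReal_ne_zero.2 hyC

end Division

end StarReduction

namespace StarReduction

/-! ### Flows -/

section Flow

variable {E : Type*} [NormedAddCommGroup E] [NormedSpace ℝ E]
  {M : Type*} [TopologicalSpace M] [ChartedSpace E M]
  {v : ∀ x : M, TangentSpace 𝓘(ℝ, E) x} {D : Set (ℝ × M)} {Φ : ℝ × M → M}

namespace IsFlow

theorem isOpen_slice (hΦ : IsFlow v D Φ) (x : M) : IsOpen {t : ℝ | (t, x) ∈ D} :=
  hΦ.isOpen_domain.preimage (by fun_prop : Continuous fun t : ℝ => (t, x))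

theorem hasMFDerivAt (hΦ : IsFlow v D Φ) {t : ℝ} {x : M} (h : (t, x) ∈ D) :
    HasMFDerivAt 𝓘(ℝ, ℝ) 𝓘(ℝ, E) (fun t => Φ (t, x)) t
      ((1 : ℝ →L[ℝ] ℝ).smulRight (v (Φ (t, x)))) :=
  (hΦ.isIntegralCurve x t h).hasMFDerivAt ((hΦ.isOpen_slice x).mem_nhds h)

theorem hasDerivAt_comp {F : Type*} [NormedAddCommGroup F] [NormedSpace ℝ F]
    (hΦ : IsFlow v D Φ) {t : ℝ} {x : M} (h : (t, x) ∈ D) {f : M → F}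
    {f' : E →L[ℝ] F} (hf : HasMFDerivAt 𝓘(ℝ, E) 𝓘(ℝ, F) f (Φ (t, x)) f') :
    HasDerivAt (fun t => f (Φ (t, x))) (f' (v (Φ (t, x)))) t := by
  have h1 : HasFDerivAt (fun t => f (Φ (t, x)))
      (f'.comp ((1 : ℝ →L[ℝ] ℝ).smulRight (v (Φ (t, x)) : E))) t :=
    (hf.comp t (hΦ.hasMFDerivAt h)).hasFDerivAt
  exact h1.hasDerivAt.congr_deriv (congrArg f' (one_smul ℝ (v (Φ (t, x)) : E)))

theorem eq_of_deriv_eq_zero (hΦ : IsFlow v D Φ) {f : M → ℝ}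
    (hf : ∀ x, MDifferentiableAt 𝓘(ℝ, E) 𝓘(ℝ, ℝ) f x) (hv : ∀ x, dR f x (v x) = 0)
    {t : ℝ} {x : M} (h : (t, x) ∈ D) : f (Φ (t, x)) = f x := by
  have hder : ∀ s ∈ {s : ℝ | (s, x) ∈ D}, HasDerivAt (fun s => f (Φ (s, x))) 0 s := fun s hs => by
    have h1 : HasDerivAt (fun s => f (Φ (s, x))) (dR f (Φ (s, x)) (v (Φ (s, x)))) s :=
      hΦ.hasDerivAt_comp hs (hf _).hasMFDerivAt
    rwa [hv] at h1
  have hconv : Convex ℝ {s : ℝ | (s, x) ∈ D} := (hΦ.ordConnected x).convex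
  have := hconv.is_const_of_fderivWithin_eq_zero (𝕜 := ℝ)
    (f := fun s => f (Φ (s, x))) (fun s hs => (hder s hs).differentiableAt.differentiableWithinAt)
    (fun s hs => by
      rw [fderivWithin_of_isOpen (hΦ.isOpen_slice x) hs]
      exact (hder s hs).hasFDerivAt.fderiv.trans (by simp))
    (x := t) (y := 0) h (hΦ.zero_mem x)
  simpa [hΦ.map_zero] using this

/-- The generator of a smooth flow is smooth. -/
theorem contMDiff_generator [IsManifold 𝓘(ℝ, E) ∞ M] (hΦ : IsFlow v D Φ) :
    ContMDiff 𝓘(ℝ, E) 𝓘(ℝ, E).tangent 1 (fun x => (⟨x, v x⟩ : TangentBundle 𝓘(ℝ, E) M)) := by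
  have : IsManifold 𝓘(ℝ, E) 1 M := .of_le (n := ∞) (by simp)
  intro x₀
  have hs : ContMDiffAt (𝓘(ℝ, E).prod 𝓘(ℝ, ℝ)) 𝓘(ℝ, E) ∞
      (Function.uncurry fun x t => Φ (t, x)) (x₀, (0 : ℝ)) :=
    ContMDiffAt.comp (g := Φ) (f := fun q : M × ℝ => (q.2, q.1)) (x₀, (0 : ℝ))
      (hΦ.contMDiffOn.contMDiffAt (hΦ.isOpen_domain.mem_nhds (hΦ.zero_mem x₀)))
      (contMDiffAt_snd.prodMk contMDiffAt_fst)
  -- The generator is the time derivative of the jointly smooth `Φ` at `t = 0`. Regularity `C¹` is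
  -- enough for uniqueness of integral curves.
  have hϕ := ContMDiffAt.mfderiv (m := 1) (fun x t => Φ (t, x)) (fun _ => (0 : ℝ)) hs
    contMDiffAt_const (by norm_cast)
  have hb : ContMDiffAt 𝓘(ℝ, E) 𝓘(ℝ, E) 1 (fun x => Φ (0, x)) x₀ := by
    simp only [hΦ.map_zero]
    exact contMDiffAt_id
  have hsec : ContMDiffAt 𝓘(ℝ, E) 𝓘(ℝ, ℝ).tangent 1
      (fun _ : M => (⟨(0 : ℝ), (1 : ℝ)⟩ : TangentBundle 𝓘(ℝ, ℝ) ℝ)) x₀ := contMDiffAt_const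
  have := ContMDiffAt.clm_apply_of_inCoordinates (b₁ := fun _ : M => (0 : ℝ))
    (b₂ := fun x => Φ (0, x)) (v := fun _ => (1 : ℝ))
    (ϕ := fun x => mfderiv 𝓘(ℝ, ℝ) 𝓘(ℝ, E) (fun t => Φ (t, x)) 0) hϕ hsec hb
  refine this.congr_of_eventuallyEq (Filter.Eventually.of_forall fun x => ?_)
  have h1 : (mfderiv 𝓘(ℝ, ℝ) 𝓘(ℝ, E) (fun t => Φ (t, x)) 0 : ℝ →L[ℝ] E) (1 : ℝ) = v (Φ (0, x)) := by
    rw [(hΦ.hasMFDerivAt (hΦ.zero_mem x)).mfderiv]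
    exact one_smul ℝ _
  have h2 : (⟨x, v x⟩ : TangentBundle 𝓘(ℝ, E) M) = ⟨Φ (0, x), v (Φ (0, x))⟩ := by rw [hΦ.map_zero]
  dsimp only
  rw [h2, ← h1]

theorem exists_Ioo_subset {s : Set ℝ} (hs : IsOpen s) (hc : s.OrdConnected) {a b : ℝ}
    (ha : a ∈ s) (hb : b ∈ s) : ∃ c d, a ∈ Set.Ioo c d ∧ b ∈ Set.Ioo c d ∧ Set.Ioo c d ⊆ s := by
  have hmin : min a b ∈ s := by rcases min_choice a b with h | h <;> rw [h] <;> assumption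
  have hmax : max a b ∈ s := by rcases max_choice a b with h | h <;> rw [h] <;> assumption
  obtain ⟨c, hc1, hc2⟩ : ∃ c < min a b, c ∈ s := by
    obtain ⟨ε, hε, h⟩ := Metric.isOpen_iff.1 hs _ hmin
    exact ⟨min a b - ε / 2, by linarith, h (by
      simp [abs_of_pos hε, hε])⟩
  obtain ⟨d, hd1, hd2⟩ : ∃ d > max a b, d ∈ s := by
    obtain ⟨ε, hε, h⟩ := Metric.isOpen_iff.1 hs _ hmax
    exact ⟨max a b + ε / 2, by linarith, h (by
      simp [abs_of_pos hε, hε])⟩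
  exact ⟨c, d, ⟨hc1.trans_le (min_le_left _ _), (le_max_left _ _).trans_lt hd1⟩,
    ⟨hc1.trans_le (min_le_right _ _), (le_max_right _ _).trans_lt hd1⟩,
    Set.Ioo_subset_Icc_self.trans (hc.out hc2 hd2)⟩

/-- The group law of the maximal flow. -/
theorem map_add [T2Space M] [IsManifold 𝓘(ℝ, E) ∞ M] (hΦ : IsFlow v D Φ) {a r : ℝ} {x : M}
    (ha : (a, x) ∈ D) (har : (r + a, x) ∈ D) :
    (r, Φ (a, x)) ∈ D ∧ Φ (r, Φ (a, x)) = Φ (r + a, x) := by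
  have : IsManifold 𝓘(ℝ, E) 1 M := .of_le (n := ∞) (by simp)
  set s : Set ℝ := {t | (t + a, x) ∈ D} with hs
  have hso : IsOpen s := hΦ.isOpen_domain.preimage (by fun_prop : Continuous fun t : ℝ => (t + a, x))
  have hsc : s.OrdConnected := by
    constructor
    intro t ht t' ht' r hr
    exact (hΦ.ordConnected x).out ht ht' ⟨by linarith [hr.1], by linarith [hr.2]⟩
  have h0 : (0 : ℝ) ∈ s := by simpa [hs] using ha
  have hγ : IsMIntegralCurveOn (fun t => Φ (t + a, x)) v s := (hΦ.isIntegralCurve x).comp_add a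
  have hγ0 : (fun t => Φ (t + a, x)) 0 = Φ (a, x) := by simp
  -- Maximality places the times of the shifted curve in the domain at `Φ (a, x)`; uniqueness on an
  -- open interval containing `0` and `r` then identifies the two curves.
  have hmax := hΦ.maximal (Φ (a, x)) _ s hso hsc h0 hγ0 hγ
  refine ⟨hmax r har, ?_⟩
  obtain ⟨c, d, hc0, hcr, hcd⟩ := exists_Ioo_subset hso hsc h0 har
  exact (isMIntegralCurveOn_Ioo_eqOn_of_contMDiff_boundaryless hc0 hΦ.contMDiff_generator
    ((hΦ.isIntegralCurve _).mono fun t ht => hmax t (hcd ht)) (hγ.mono hcd)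
    ((hΦ.map_zero _).trans hγ0.symm)) hcr

theorem mem_of_mem_uIcc (hΦ : IsFlow v D Φ)
    {t r : ℝ} {x : M} (h : (t, x) ∈ D) (hr : r ∈ Set.uIcc 0 t) : (r, x) ∈ D :=
  (hΦ.ordConnected x).uIcc_subset (hΦ.zero_mem x) h hr

theorem continuousOn_orbit (hΦ : IsFlow v D Φ)
    {G : M → ℂ} (hG : Continuous G) (x : M) :
    ContinuousOn (fun r => G (Φ (r, x))) {r | (r, x) ∈ D} :=
  hG.comp_continuousOn (hΦ.contMDiffOn.continuousOn.comp (by fun_prop) fun _ hr => hr)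

theorem map_neg [T2Space M] [IsManifold 𝓘(ℝ, E) ∞ M] (hΦ : IsFlow v D Φ) {t : ℝ} {x : M}
    (h : (t, x) ∈ D) : (-t, Φ (t, x)) ∈ D ∧ Φ (-t, Φ (t, x)) = x := by
  have := hΦ.map_add (r := -t) h (by simpa using hΦ.zero_mem x)
  simpa [hΦ.map_zero] using this

/-- `∫_0^t G(Φ_r(s)) dr` in terms of the end point `x = Φ_t(s)`. -/
theorem integral_eq [T2Space M] [IsManifold 𝓘(ℝ, E) ∞ M] (hΦ : IsFlow v D Φ) (G : M → ℂ)
    {t : ℝ} {x : M} (h : (-t, x) ∈ D) :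
    ∫ r in (0 : ℝ)..t, G (Φ (r, Φ (-t, x))) =
      (t : ℂ) * ∫ s in (0 : ℝ)..1, G (Φ (-(s * t), x)) := by
  have h1 : ∫ r in (0 : ℝ)..t, G (Φ (r, Φ (-t, x))) = ∫ r in (0 : ℝ)..t, G (Φ (r + -t, x)) := by
    refine intervalIntegral.integral_congr fun r hr => ?_
    have hmem : (r + -t, x) ∈ D := by
      refine hΦ.mem_of_mem_uIcc h ?_
      rcases le_total 0 t with ht | ht
      · rw [Set.uIcc_of_le ht] at hr
        rw [Set.uIcc_of_ge (by linarith)]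
        exact ⟨by linarith [hr.1], by linarith [hr.2]⟩
      · rw [Set.uIcc_of_ge ht] at hr
        rw [Set.uIcc_of_le (by linarith)]
        exact ⟨by linarith [hr.1], by linarith [hr.2]⟩
    exact congrArg G (hΦ.map_add h hmem).2
  rw [h1, intervalIntegral.integral_comp_add_right (fun r => G (Φ (r, x))), zero_add,
    add_neg_cancel]
  -- Rescaling time by `-t` gives the fixed limits `0` and `1`, as differentiation under the
  -- integral requires, for either sign of `t`.
  have h2 := intervalIntegral.smul_integral_comp_mul_right (a := 0) (b := 1)
    (fun r => G (Φ (r, x))) (-t)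
  rw [zero_mul, one_mul, intervalIntegral.integral_symm (-t) 0, neg_smul, neg_inj] at h2
  rw [← h2, Complex.real_smul]
  simp only [mul_neg]

theorem contMDiffOn_comp_chart [IsManifold 𝓘(ℝ, E) ∞ M] (hΦ : IsFlow v D Φ)
    (x₀ : M) {W : Set (E × ℝ)} (hW : IsOpen W) (hWt : ∀ q ∈ W, q.1 ∈ (chartAt E x₀).target)
    {α : E × ℝ → ℝ} (hα : ContDiffOn ℝ ∞ α W) :
    IsOpen (W ∩ (fun q : E × ℝ => (α q, (chartAt E x₀).symm q.1)) ⁻¹' D) ∧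
      ContMDiffOn 𝓘(ℝ, E × ℝ) 𝓘(ℝ, E) ∞ (fun q : E × ℝ => Φ (α q, (chartAt E x₀).symm q.1))
        (W ∩ (fun q : E × ℝ => (α q, (chartAt E x₀).symm q.1)) ⁻¹' D) := by
  have h1 : ContMDiffOn 𝓘(ℝ, E × ℝ) 𝓘(ℝ, E) ∞ (fun q : E × ℝ => (chartAt E x₀).symm q.1) W :=
    ContMDiffOn.comp (t := (chartAt E x₀).target) (g := (chartAt E x₀).symm)
      (f := fun q : E × ℝ => q.1)
      contMDiffOn_chart_symm contDiff_fst.contMDiff.contMDiffOn hWt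
  have h2 : ContMDiffOn 𝓘(ℝ, E × ℝ) (𝓘(ℝ, ℝ).prod 𝓘(ℝ, E)) ∞
      (fun q : E × ℝ => (α q, (chartAt E x₀).symm q.1)) W := hα.contMDiffOn.prodMk h1
  exact ⟨h2.continuousOn.isOpen_inter_preimage hW hΦ.isOpen_domain,
    hΦ.contMDiffOn.comp (h2.mono Set.inter_subset_left) fun q hq => hq.2⟩

end IsFlow

end Flow

end StarReduction

namespace StarReduction

/-! ### Integration along the orbits starting from a transversal section -/

section Transversal

variable {E : Type*} [NormedAddCommGroup E] [NormedSpace ℝ E]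
  {M : Type*} [TopologicalSpace M] [ChartedSpace E M]
  {D : Set (ℝ × M)} {Φ : ℝ × M → M} {Ω : SymplecticForm E M} {J : C^∞⟮𝓘(ℝ, E), M; ℝ⟯}

variable [FiniteDimensional ℝ E]

/-- `J` is constant along its own flow, because `dJ(X_J) = Ω(X_J, X_J) = 0`. -/
theorem IsFlow.mem_constraintSurface (hΦ : IsFlow (hamiltonianVectorField Ω J) D Φ) {t : ℝ} {x : M}
    (h : (t, x) ∈ D) (hx : x ∈ constraintSurface J) : Φ (t, x) ∈ constraintSurface J :=
  (hΦ.eq_of_deriv_eq_zero (mdifferentiableAt_real J) (dR_hamiltonianVectorField_self Ω J) h).trans hx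

variable [T2Space M] [IsManifold 𝓘(ℝ, E) ∞ M]

/-- The time needed to reach a point of the constraint surface from the section is, locally, the
restriction of a smooth function. -/
theorem exists_smooth_time (hΦ : IsFlow (hamiltonianVectorField Ω J) D Φ) {σ : Set M}
    (hσ : IsTransversalSection Ω J D Φ σ) {s : M} {t : ℝ} (hs : s ∈ σ) (hts : (t, s) ∈ D) :
    ∃ V : Set E, IsOpen V ∧ chartAt E (Φ (t, s)) (Φ (t, s)) ∈ V ∧
      V ⊆ (chartAt E (Φ (t, s))).target ∧ ∃ τ : E → ℝ, ContDiffOn ℝ ∞ τ V ∧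
      ∀ y ∈ V, (-τ y, (chartAt E (Φ (t, s))).symm y) ∈ D ∧
        ((chartAt E (Φ (t, s))).symm y ∈ constraintSurface J →
          Φ (-τ y, (chartAt E (Φ (t, s))).symm y) ∈ σ) := by
  have : CompleteSpace E := FiniteDimensional.complete ℝ E
  obtain ⟨W₀, hW₀, u, hu, hσu, hdu⟩ := hσ.transversal s hs
  obtain ⟨W, hWW₀, hWo, hsW⟩ := mem_nhds_iff.1 hW₀
  set x₀ := Φ (t, s) with hx₀
  set e := chartAt E x₀ with he
  obtain ⟨hneg, hnegs⟩ := hΦ.map_neg hts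
  have hex : e.symm (e x₀) = x₀ := e.left_inv (mem_chart_source E x₀)
  obtain ⟨hUo, hz⟩ := hΦ.contMDiffOn_comp_chart x₀ (W := e.target ×ˢ Set.univ)
    (e.open_target.prod isOpen_univ) (fun q hq => hq.1) (α := fun q => -q.2) contDiff_snd.neg.contDiffOn
  set U := (e.target ×ˢ Set.univ) ∩ (fun q : E × ℝ => (-q.2, e.symm q.1)) ⁻¹' D with hU
  set z : E × ℝ → M := fun q => Φ (-q.2, e.symm q.1) with hzdef
  have hU'o : IsOpen (U ∩ z ⁻¹' W) := hz.continuousOn.isOpen_inter_preimage hUo hWo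
  have huz : ContDiffOn ℝ ∞ (fun q => u (z q)) (U ∩ z ⁻¹' W) :=
    contMDiffOn_iff_contDiffOn.1 ((hu.mono hWW₀).comp (hz.mono Set.inter_subset_left) fun q hq => hq.2)
  have hz0 : z (e x₀, t) = s := by simp only [hzdef, hex]; exact hnegs
  have h0 : (e x₀, t) ∈ U ∩ z ⁻¹' W := by
    refine ⟨⟨⟨e.map_source (mem_chart_source E x₀), trivial⟩, ?_⟩, ?_⟩
    · simp only [Set.mem_preimage, hex]; exact hneg
    · simp only [Set.mem_preimage, hz0]; exact hsW
  have hderiv : fderiv ℝ (fun q => u (z q)) (e x₀, t) (0, 1) =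
      - dR u s (hamiltonianVectorField Ω J s) := by
    have h1 : HasFDerivAt (fun q => u (z q)) (fderiv ℝ (fun q => u (z q)) (e x₀, t)) (e x₀, t) :=
      ((huz.contDiffAt (hU'o.mem_nhds h0)).differentiableAt (by simp)).hasFDerivAt
    have h2 : HasDerivAt (fun r : ℝ => (e x₀, r)) ((0 : E), (1 : ℝ)) t :=
      (hasDerivAt_const t (e x₀)).prodMk (hasDerivAt_id t)
    have h3 := h1.comp_hasDerivAt t h2
    have hus : HasMFDerivAt 𝓘(ℝ, E) 𝓘(ℝ, ℝ) u (Φ (-t, x₀))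
        (mfderiv 𝓘(ℝ, E) 𝓘(ℝ, ℝ) u (Φ (-t, x₀))) := by
      rw [hnegs]
      exact ((hu.contMDiffAt hW₀).mdifferentiableAt (by simp)).hasMFDerivAt
    have h4 : HasDerivAt (fun t => u (Φ (t, x₀)))
        (dR u (Φ (-t, x₀)) (hamiltonianVectorField Ω J (Φ (-t, x₀)))) (-t) :=
      hΦ.hasDerivAt_comp hneg hus
    have h5 := h4.scomp t (hasDerivAt_neg t)
    have h6 : (fun q => u (z q)) ∘ (fun r : ℝ => (e x₀, r)) = (fun t => u (Φ (t, x₀))) ∘ Neg.neg := by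
      funext r
      simp [hzdef, hex]
    rw [h6] at h3
    rw [h3.unique h5, hnegs]
    simp
  -- The equation `u(Φ(-τ, y)) = 0` is solved for `τ`. Its time derivative is `-du(X_J)`, nonzero by
  -- transversality. The solution is defined also off `C`; only for `y ∈ C` does the end point lie
  -- on `σ`.
  obtain ⟨V, hVo, hxV, τ, hτ, -, hτz⟩ := exists_smooth_implicit hU'o huz h0
    (by rw [hz0]; exact ((hσu s (mem_of_mem_nhds hW₀)).1 hs).2)
    (by rw [hderiv]; exact neg_ne_zero.2 hdu)
  refine ⟨V, hVo, hxV, fun y hy => (hτz y hy).1.1.1.1, τ, hτ, fun y hy => ⟨(hτz y hy).1.1.2, fun hC => ?_⟩⟩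
  obtain ⟨⟨⟨-, hD⟩, hyW⟩, hu0⟩ := hτz y hy
  exact (hσu _ (hWW₀ hyW)).2 ⟨hΦ.mem_constraintSurface hD hC, hu0⟩

end Transversal

/-! ### Orbit integrals and the transport equation on `C` -/

section OrbitIntegral

variable {E : Type*} [NormedAddCommGroup E] [NormedSpace ℝ E]
  {M : Type*} [TopologicalSpace M] [ChartedSpace E M]
  {D : Set (ℝ × M)} {Φ : ℝ × M → M} {Ω : SymplecticForm E M} {J : C^∞⟮𝓘(ℝ, E), M; ℝ⟯}
  {σ : Set M}

/-- The function `Φ_t(s) ↦ -i ∫_0^t G(Φ_r(s)) dr` on the constraint surface. -/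
noncomputable def orbitIntegral (hσ : IsTransversalSection Ω J D Φ σ) (G : M → ℂ)
    (x : constraintSurface J) : ℂ :=
  -Complex.I * ∫ r in (0 : ℝ)..(hσ.existsUnique x x.2).choose.1,
    G (Φ (r, (hσ.existsUnique x x.2).choose.2))

theorem orbitIntegral_apply (hσ : IsTransversalSection Ω J D Φ σ) (G : M → ℂ) {s : M} {t : ℝ}
    (hs : s ∈ σ) (hts : (t, s) ∈ D) (hC : Φ (t, s) ∈ constraintSurface J) :
    orbitIntegral hσ G ⟨Φ (t, s), hC⟩ = -Complex.I * ∫ r in (0 : ℝ)..t, G (Φ (r, s)) := by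
  have h := (hσ.existsUnique _ hC).choose_spec
  have h2 : (t, s) = (hσ.existsUnique _ hC).choose := h.2 (t, s) ⟨hts, hs, rfl⟩
  rw [orbitIntegral, ← h2]

theorem SmoothFn.continuous (f : SmoothFn E M) : Continuous f.1 :=
  (show ContMDiff 𝓘(ℝ, E) 𝓘(ℝ, ℂ) ∞ f.1 from f.2).continuous

variable [FiniteDimensional ℝ E] [T2Space M] [IsManifold 𝓘(ℝ, E) ∞ M]

/-- Near a point of `C` the value at `x` is `-i τ ∫_0^1 G(Φ(-sτ, x)) ds`, with `τ` the smooth local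
transit time. This expression makes sense on an open set of `M` and is the smooth extension that
membership in `C^∞(C)` asks for. -/
theorem orbitIntegral_mem (hΦ : IsFlow (hamiltonianVectorField Ω J) D Φ)
    (hσ : IsTransversalSection Ω J D Φ σ) (G : SmoothFn E M) :
    orbitIntegral hσ G.1 ∈ smoothAlgebraOn E (constraintSurface J) := by
  rintro ⟨x₀, hx₀⟩
  obtain ⟨⟨t, s⟩, ⟨hts, hs, rfl⟩, -⟩ := hσ.existsUnique x₀ hx₀
  obtain ⟨V, hVo, hxV, hVt, τ, hτ, hτσ⟩ := exists_smooth_time hΦ hσ hs hts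
  dsimp only at hτσ hxV hVt hx₀ ⊢
  set x₀ := Φ (t, s)
  set e := chartAt E x₀ with he
  have hα : ContDiffOn ℝ ∞ (fun q : E × ℝ => -(q.2 * τ q.1)) (V ×ˢ Set.univ) :=
    (contDiffOn_snd.mul (hτ.comp contDiffOn_fst fun q hq => hq.1)).neg
  obtain ⟨hUo, hz⟩ := hΦ.contMDiffOn_comp_chart x₀ (hVo.prod isOpen_univ)
    (fun q hq => hVt hq.1) hα
  have hGs : ContMDiff 𝓘(ℝ, E) 𝓘(ℝ, ℂ) ∞ G.1 := G.2
  have hint := contDiffOn_integral_of_contDiffOn hUo hVo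
    (contMDiffOn_iff_contDiffOn.1 (hGs.comp_contMDiffOn hz)) (fun y hy r hr =>
      ⟨⟨hy, trivial⟩, hΦ.mem_of_mem_uIcc (hτσ y hy).1 (by
        have hr' := hr
        rcases le_total 0 (τ y) with h | h
        · rw [Set.uIcc_of_ge (by linarith)]
          exact ⟨by nlinarith [hr.2], by nlinarith [hr.1]⟩
        · rw [Set.uIcc_of_le (by linarith)]
          exact ⟨by nlinarith [hr.1], by nlinarith [hr.2]⟩)⟩)
  have hfull := (contDiffOn_const (c := -Complex.I)).mul
    ((Complex.ofRealCLM.contDiff.comp_contDiffOn hτ).mul hint)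
  refine ⟨e.source ∩ e ⁻¹' V, (e.isOpen_inter_preimage hVo).mem_nhds ⟨mem_chart_source E x₀, hxV⟩,
    _, hfull.contMDiffOn.comp (contMDiffOn_chart.mono Set.inter_subset_left) fun y hy => hy.2, ?_⟩
  rintro ⟨x, hx⟩ ⟨hxs, hxV⟩
  obtain ⟨hD, hC⟩ := hτσ (e x) hxV
  rw [e.left_inv hxs] at hD hC
  have hback := hΦ.map_neg hD
  rw [neg_neg] at hback
  have hmem : Φ (τ (e x), Φ (-τ (e x), x)) ∈ constraintSurface J := by rwa [hback.2]
  have hval := orbitIntegral_apply hσ G.1 (hC hx) hback.1 hmem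
  rw [hΦ.integral_eq G.1 hD] at hval
  have hsub : (⟨Φ (τ (e x), Φ (-τ (e x), x)), hmem⟩ : constraintSurface J) = ⟨x, hx⟩ :=
    Subtype.ext hback.2
  rw [hsub] at hval
  have hxe : e.symm (e x) = x := e.left_inv hxs
  rw [hval]
  simp [← he, hxe]

/-- `G ↦ (Φ_t(s) ↦ -i ∫_0^t G(Φ_r(s)) dr)` as a linear map `C^∞(M) → C^∞(C)`. -/
noncomputable def orbitIntegralMap (hΦ : IsFlow (hamiltonianVectorField Ω J) D Φ)
    (hσ : IsTransversalSection Ω J D Φ σ) :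
    SmoothFn E M →ₗ[ℂ] SmoothFnOn E (constraintSurface J) where
  toFun G := ⟨orbitIntegral hσ G.1, orbitIntegral_mem hΦ hσ G⟩
  map_add' G G' := by
    refine Subtype.ext (funext fun x => ?_)
    have hD := (hσ.existsUnique x x.2).choose_spec.1.1
    have hi : ∀ G : SmoothFn E M, IntervalIntegrable
        (fun r => G.1 (Φ (r, (hσ.existsUnique x x.2).choose.2))) MeasureTheory.volume 0
        (hσ.existsUnique x x.2).choose.1 := fun G =>
      ((hΦ.continuousOn_orbit G.continuous _).mono
        fun r hr => hΦ.mem_of_mem_uIcc hD hr).intervalIntegrable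
    have := intervalIntegral.integral_add (hi G) (hi G')
    change orbitIntegral hσ (fun y => G.1 y + G'.1 y) x =
      orbitIntegral hσ G.1 x + orbitIntegral hσ G'.1 x
    rw [orbitIntegral, this, mul_add]
    rfl
  map_smul' c G := by
    refine Subtype.ext (funext fun x => ?_)
    change orbitIntegral hσ (fun y => c * G.1 y) x = c * orbitIntegral hσ G.1 x
    rw [orbitIntegral, intervalIntegral.integral_const_mul, orbitIntegral]
    ring

theorem orbitIntegralMap_apply (hΦ : IsFlow (hamiltonianVectorField Ω J) D Φ)
    (hσ : IsTransversalSection Ω J D Φ σ) (G : SmoothFn E M) {s : M} {t : ℝ}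
    (hs : s ∈ σ) (hts : (t, s) ∈ D) (hC : Φ (t, s) ∈ constraintSurface J) :
    (orbitIntegralMap hΦ hσ G).1 ⟨Φ (t, s), hC⟩ =
      -Complex.I * ∫ r in (0 : ℝ)..t, G.1 (Φ (r, s)) :=
  orbitIntegral_apply hσ G.1 hs hts hC

/-- The orbit integral solves the transport equation `X_J f = -i G` on the constraint surface. -/
theorem dC_of_restrict_eq_orbitIntegralMap (hΦ : IsFlow (hamiltonianVectorField Ω J) D Φ)
    (hσ : IsTransversalSection Ω J D Φ σ) {f G : SmoothFn E M}
    (h : restrict E (constraintSurface J) f = orbitIntegralMap hΦ hσ G) {x : M}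
    (hx : x ∈ constraintSurface J) :
    dC f.1 x (hamiltonianVectorField Ω J x) = -Complex.I * G.1 x := by
  obtain ⟨⟨t, s⟩, ⟨hts, hs, rfl⟩, -⟩ := hσ.existsUnique x hx
  dsimp only at hts hs ⊢
  have h1 : HasDerivAt (fun t => f.1 (Φ (t, s)))
      (dC f.1 (Φ (t, s)) (hamiltonianVectorField Ω J (Φ (t, s)))) t :=
    hΦ.hasDerivAt_comp hts (f.mdifferentiableAt _).hasMFDerivAt
  have hcont := hΦ.continuousOn_orbit G.continuous s
  have hopen := hΦ.isOpen_slice s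
  have h2 : HasDerivAt (fun t => -Complex.I * ∫ r in (0 : ℝ)..t, G.1 (Φ (r, s)))
      (-Complex.I * G.1 (Φ (t, s))) t :=
    (intervalIntegral.integral_hasDerivAt_right
      (hcont.mono fun r hr => hΦ.mem_of_mem_uIcc hts hr).intervalIntegrable
      (hcont.stronglyMeasurableAtFilter hopen t hts)
      (hcont.continuousAt (hopen.mem_nhds hts))).const_mul _
  -- `f` is known only on `C`, but the orbit stays in `C`, so its derivative along the orbit is
  -- determined.
  refine h1.unique (h2.congr_of_eventuallyEq ?_)
  filter_upwards [hopen.mem_nhds hts] with r hr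
  have hC := hΦ.mem_constraintSurface hr (hσ.subset hs)
  rw [← orbitIntegralMap_apply hΦ hσ G hs hr hC, ← h]
  rfl

end OrbitIntegral

end StarReduction

namespace StarReduction

/-! ### The star ideal and its idealizer -/

section Ideal

variable {E : Type*} [NormedAddCommGroup E] [NormedSpace ℝ E]
  {M : Type*} [TopologicalSpace M] [ChartedSpace E M]
  {Ω : SymplecticForm E M} {J : C^∞⟮𝓘(ℝ, E), M; ℝ⟯}

theorem coeff_restrictSeries (f : (SmoothFn E M)⟦X⟧) (n : ℕ) :
    PowerSeries.coeff n (restrictSeries E (constraintSurface J) f) =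
      restrict E (constraintSurface J) (PowerSeries.coeff n f) := by
  simp [restrictSeries, mapSeries]

theorem restrictSeries_eq_zero_iff {f : (SmoothFn E M)⟦X⟧} :
    restrictSeries E (constraintSurface J) f = 0 ↔
      ∀ n, ∀ x ∈ constraintSurface J, (PowerSeries.coeff n f).1 x = 0 := by
  constructor
  · intro h n x hx
    have h1 := congrArg (PowerSeries.coeff n) h
    rw [coeff_restrictSeries, map_zero] at h1
    exact congrFun (congrArg Subtype.val h1) ⟨x, hx⟩
  · intro h
    refine PowerSeries.ext fun n => ?_
    rw [coeff_restrictSeries, map_zero]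
    exact Subtype.ext (funext fun x => h n x x.2)

theorem coeff_mul_constraintSeries (q : (SmoothFn E M)⟦X⟧) (n : ℕ) :
    PowerSeries.coeff n (q * constraintSeries J) = PowerSeries.coeff n q * ofReal E J := by
  rw [constraintSeries, PowerSeries.coeff_mul_C]

theorem restrictSeries_mul_constraintSeries (q : (SmoothFn E M)⟦X⟧) :
    restrictSeries E (constraintSurface J) (q * constraintSeries J) = 0 := by
  refine restrictSeries_eq_zero_iff.2 fun n x hx => ?_
  rw [coeff_mul_constraintSeries]
  have h0 : J x = 0 := hx
  change _ * ((J x : ℝ) : ℂ) = 0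
  rw [h0, Complex.ofReal_zero, mul_zero]

theorem mul_constraintSeries_injective
    (hJ : ∀ x ∈ constraintSurface J, mfderiv 𝓘(ℝ, E) 𝓘(ℝ, ℝ) J x ≠ 0)
    {q q' : (SmoothFn E M)⟦X⟧} (h : q * constraintSeries J = q' * constraintSeries J) : q = q' :=
  PowerSeries.ext fun n => quotient_unique hJ <| by
    rw [← coeff_mul_constraintSeries, ← coeff_mul_constraintSeries, h]

namespace Prolongation

variable (p : Prolongation J)

theorem restrictSeries_prol (f : (SmoothFn E M)⟦X⟧) :
    restrictSeries E (constraintSurface J) (p.prol f) = restrictSeries E (constraintSurface J) f :=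
  p.restrict_extend _

theorem prol_extend (g : (SmoothFnOn E (constraintSurface J))⟦X⟧) :
    p.prol (p.extend g) = p.extend g :=
  congrArg p.extend (p.restrict_extend g)

theorem prol_eq_zero {f : (SmoothFn E M)⟦X⟧} (h : restrictSeries E (constraintSurface J) f = 0) :
    p.prol f = 0 :=
  (congrArg p.extend h).trans (map_zero p.extend)

theorem mem_pure {f : (SmoothFn E M)⟦X⟧} : f ∈ p.pure ↔ p.prol f = f := by
  rw [pure, LinearMap.mem_eqLocus, LinearMap.id_apply, eq_comm]

theorem formalSum_mem_pure {G : ℕ → (SmoothFn E M)⟦X⟧} (hG : ∀ n, G n ∈ p.pure) :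
    formalSum G ∈ p.pure :=
  p.mem_pure.2 (formalSum_mem_eqLocus fun n => p.mem_pure.1 (hG n))

variable [FiniteDimensional ℝ E] [IsManifold 𝓘(ℝ, E) ∞ M]
  (hJ : ∀ x ∈ constraintSurface J, mfderiv 𝓘(ℝ, E) 𝓘(ℝ, ℝ) J x ≠ 0)
include hJ

/-- Since `i^* ∘ p = id`, the difference vanishes on `C` and can be divided by `J` coefficientwise;
the default value of `component` is never taken. -/
theorem sub_prol_eq (f : (SmoothFn E M)⟦X⟧) :
    f - p.prol f = p.component f * constraintSeries J := by
  have hz : restrictSeries E (constraintSurface J) (f - p.prol f) = 0 := by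
    rw [map_sub, restrictSeries_prol, sub_self]
  choose q hq using fun n => exists_quotient hJ (restrictSeries_eq_zero_iff.1 hz n)
  have h : ∃ q : (SmoothFn E M)⟦X⟧, f - p.prol f = q * constraintSeries J :=
    ⟨PowerSeries.mk q, PowerSeries.ext fun n => by
      rw [coeff_mul_constraintSeries, PowerSeries.coeff_mk, hq n]⟩
  rw [component, dif_pos h]
  exact h.choose_spec

theorem component_eq {f q : (SmoothFn E M)⟦X⟧} (h : f - p.prol f = q * constraintSeries J) :
    p.component f = q :=
  mul_constraintSeries_injective hJ ((p.sub_prol_eq hJ f).symm.trans h)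

/-- The component along `J` as a linear map. -/
noncomputable def componentMap : (SmoothFn E M)⟦X⟧ →ₗ[ℂ⟦X⟧] (SmoothFn E M)⟦X⟧ where
  toFun := p.component
  map_add' f g := p.component_eq hJ <| by
    rw [map_add, add_sub_add_comm, p.sub_prol_eq hJ, p.sub_prol_eq hJ, add_mul]
  map_smul' c f := p.component_eq hJ <| by
    rw [map_smul, ← smul_sub, p.sub_prol_eq hJ, RingHom.id_apply, smul_mul_assoc]

end Prolongation

namespace StarProduct

variable (star : StarProduct Ω)

theorem opSeries_zero (f g : (SmoothFn E M)⟦X⟧) : star.opSeries 0 f g = f * g := by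
  refine PowerSeries.ext fun n => ?_
  rw [opSeries, convolve, PowerSeries.coeff_mk, PowerSeries.coeff_mul]
  exact Finset.sum_congr rfl fun q _ => star.op_zero _ _

theorem opSeries_C_left (k : ℕ) (a : SmoothFn E M) (f : (SmoothFn E M)⟦X⟧) :
    star.opSeries k (PowerSeries.C a) f = mapCoeff (star.op k a) f := by
  have h : star.opMap k (PowerSeries.C a) = mapCoeff (star.op k a) := linearMap_ext_C fun b => by
    rw [opMap_apply, opSeries_C_C]
    refine PowerSeries.ext fun n => ?_
    rw [coeff_mapCoeff, PowerSeries.coeff_C, PowerSeries.coeff_C]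
    split_ifs <;> simp
  exact LinearMap.congr_fun h f

theorem opSeries_C_right (k : ℕ) (a : SmoothFn E M) (f : (SmoothFn E M)⟦X⟧) :
    star.opSeries k f (PowerSeries.C a) = mapCoeff ((star.op k).flip a) f := by
  have h : (star.opMap k).flip (PowerSeries.C a) = mapCoeff ((star.op k).flip a) :=
    linearMap_ext_C fun b => by
      rw [LinearMap.flip_apply, opMap_apply, opSeries_C_C]
      refine PowerSeries.ext fun n => ?_
      rw [coeff_mapCoeff, PowerSeries.coeff_C, PowerSeries.coeff_C]
      split_ifs <;> simp
  exact LinearMap.congr_fun h f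

theorem coeff_antisymm_constraintSeries (k m : ℕ) (f : (SmoothFn E M)⟦X⟧) :
    PowerSeries.coeff m (star.antisymm k (constraintSeries J) f) =
      star.op k (ofReal E J) (PowerSeries.coeff m f) -
        star.op k (PowerSeries.coeff m f) (ofReal E J) := by
  rw [antisymm, constraintSeries, opSeries_C_left, opSeries_C_right, map_sub, coeff_mapCoeff,
    coeff_mapCoeff, LinearMap.flip_apply]

theorem antisymm_zero (f g : (SmoothFn E M)⟦X⟧) : star.antisymm 0 f g = 0 := by
  rw [antisymm, opSeries_zero, opSeries_zero, mul_comm, sub_self]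

/-- `g ↦ M_k(f, g) - M_k(g, f)` as a linear map. -/
noncomputable def antisymmMap (k : ℕ) (f : (SmoothFn E M)⟦X⟧) :
    (SmoothFn E M)⟦X⟧ →ₗ[ℂ⟦X⟧] (SmoothFn E M)⟦X⟧ :=
  star.opMap k f - (star.opMap k).flip f

theorem antisymmMap_apply (k : ℕ) (f g : (SmoothFn E M)⟦X⟧) :
    star.antisymmMap k f g = star.antisymm k f g := rfl

theorem mul_sub_mul_eq (f g : (SmoothFn E M)⟦X⟧) :
    star.mul f g - star.mul g f = formalSum fun k => star.antisymm k f g := by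
  refine PowerSeries.ext fun n => ?_
  simp [mul, formalSum, antisymm]

theorem coeff_antisymm_one_apply [FiniteDimensional ℝ E] (m : ℕ) (f : (SmoothFn E M)⟦X⟧) (x : M) :
    (PowerSeries.coeff m (star.antisymm 1 (constraintSeries J) f)).1 x =
      -Complex.I * dC (PowerSeries.coeff m f).1 x (hamiltonianVectorField Ω J x) := by
  rw [coeff_antisymm_constraintSeries]
  refine (congrFun (star.op_one_comm _ _) x).trans ?_
  rw [Pi.smul_apply, poisson_ofReal_left, smul_eq_mul]
  ring

end StarProduct

/-- Testing on `g = J` extracts `X_J f`. Conversely, every coefficient of an element of `I` is a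
multiple `r J`, whose bracket with a coefficient of `f` is `r` times the derivative of that
coefficient along `X_J`, on `C`. -/
theorem mem_classicalB_iff [FiniteDimensional ℝ E] [IsManifold 𝓘(ℝ, E) ∞ M]
    (hJ : ∀ x ∈ constraintSurface J, mfderiv 𝓘(ℝ, E) 𝓘(ℝ, ℝ) J x ≠ 0) {f : (SmoothFn E M)⟦X⟧} :
    f ∈ classicalB Ω J ↔ ∀ n, ∀ x ∈ constraintSurface J,
      dC (PowerSeries.coeff n f).1 x (hamiltonianVectorField Ω J x) = 0 := by
  have hcoeff : ∀ (g : (SmoothFn E M)⟦X⟧) (n : ℕ) (x : constraintSurface J),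
      PowerSeries.coeff n (restrictFun (constraintSurface J) (poissonSeries Ω f g)) x =
        ∑ q ∈ Finset.HasAntidiagonal.antidiagonal n,
          poisson Ω (PowerSeries.coeff q.1 f) (PowerSeries.coeff q.2 g) x := by
    intro g n x
    have : PowerSeries.coeff n (restrictFun (constraintSurface J) (poissonSeries Ω f g)) x =
        PowerSeries.coeff n (poissonSeries Ω f g) x := by
      simp only [restrictFun, mapSeries, LinearMap.coe_mk, AddHom.coe_mk, PowerSeries.coeff_map]
      rfl
    rw [this, poissonSeries, convolve, PowerSeries.coeff_mk, Finset.sum_apply]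
  constructor
  · intro hf n x hx
    have h1 : constraintSeries J ∈ vanishingIdeal J := LinearMap.mem_ker.2 <| by
      rw [← one_mul (constraintSeries J)]
      exact restrictSeries_mul_constraintSeries 1
    have h2 := hcoeff (constraintSeries J) n ⟨x, hx⟩
    rw [hf _ h1, Finset.sum_eq_single (n, 0)] at h2
    · have h3 := poisson_mul_ofReal Ω (PowerSeries.coeff n f) 1 hx
      rw [one_mul] at h3
      have h4 : PowerSeries.coeff 0 (constraintSeries J) = ofReal E J := by
        rw [constraintSeries, PowerSeries.coeff_zero_C]
      rw [map_zero, h4, h3] at h2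
      simpa using h2.symm
    · rintro ⟨a, b⟩ h hne
      rw [Finset.HasAntidiagonal.mem_antidiagonal] at h
      have hb : b ≠ 0 := fun h1 => hne (Prod.ext (by dsimp only at *; omega) h1)
      -- Writing the zero coefficient as `0 * J` lets the same bracket formula dispose of it.
      have h4 : PowerSeries.coeff b (constraintSeries J) = (0 : SmoothFn E M) * ofReal E J := by
        rw [constraintSeries, PowerSeries.coeff_C, if_neg hb, zero_mul]
      dsimp only
      rw [h4, poisson_mul_ofReal Ω _ _ hx]
      exact zero_mul _
    · intro h
      exact absurd (Finset.HasAntidiagonal.mem_antidiagonal.2 (by simp)) h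
  · intro hf g hg
    have hg' := restrictSeries_eq_zero_iff.1 (LinearMap.mem_ker.1 hg)
    refine PowerSeries.ext fun n => funext fun x => ?_
    rw [hcoeff, map_zero]
    refine Finset.sum_eq_zero fun q _ => ?_
    obtain ⟨r, hr⟩ := exists_quotient hJ (hg' q.2)
    rw [hr, poisson_mul_ofReal Ω _ _ x.2, hf _ _ x.2, mul_zero]

variable (star : StarProduct Ω)

theorem mem_starIdeal_mul (g f : (SmoothFn E M)⟦X⟧) (hf : f ∈ starIdeal star J) :
    star.mul g f ∈ starIdeal star J := by
  obtain ⟨h, rfl⟩ := hf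
  exact ⟨star.mul g h, (star.mul_assoc g h _).symm⟩

/-- With `[a, b] = a * b - b * a`, associativity gives `[f, h * J] = [f, h] * J - h * [J, f]`, and
`I^*` is a left ideal containing `J = 1 * J`. -/
theorem mem_starB_iff {f : (SmoothFn E M)⟦X⟧} :
    f ∈ starB star J ↔
      star.mul (constraintSeries J) f - star.mul f (constraintSeries J) ∈ starIdeal star J := by
  constructor
  · intro hf
    have h := hf (constraintSeries J) ⟨1, (star.one_mul _).symm⟩
    rw [← neg_sub]
    exact neg_mem h
  · rintro hf _ ⟨h, rfl⟩
    have h1 : star.mul f (star.mul h (constraintSeries J)) -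
        star.mul (star.mul h (constraintSeries J)) f =
        star.mul (star.mul f h - star.mul h f) (constraintSeries J) -
          star.mul h (star.mul (constraintSeries J) f - star.mul f (constraintSeries J)) := by
      have e1 : ∀ a b c, star.mul (a - b) c = star.mul a c - star.mul b c := fun a b c =>
        star.mulMap.map_sub₂ a b c
      have e2 : ∀ a b c, star.mul c (a - b) = star.mul c a - star.mul c b := fun a b c =>
        map_sub (star.mulMap c) a b
      rw [e1, e2, star.mul_assoc h, star.mul_assoc f, star.mul_assoc h]
      abel
    rw [h1]
    exact sub_mem ⟨_, rfl⟩ (mem_starIdeal_mul star h _ hf)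

variable (p : Prolongation J) [FiniteDimensional ℝ E] [IsManifold 𝓘(ℝ, E) ∞ M]
  (hJ : ∀ x ∈ constraintSurface J, mfderiv 𝓘(ℝ, E) 𝓘(ℝ, ℝ) J x ≠ 0)

/-- The operators `T_n` as linear maps. -/
noncomputable def opTMap : ℕ → (SmoothFn E M)⟦X⟧ →ₗ[ℂ⟦X⟧] (SmoothFn E M)⟦X⟧
  | 0 => LinearMap.id
  | m + 1 => - ∑ j : Fin (m + 1),
      opTMap (m - j) ∘ₗ (star.opMap (j + 1)).flip (constraintSeries J) ∘ₗ p.componentMap hJ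
  termination_by n => n

theorem opTMap_zero (f : (SmoothFn E M)⟦X⟧) : opTMap star p hJ 0 f = f := by
  rw [opTMap, LinearMap.id_apply]

theorem opTMap_succ (m : ℕ) (f : (SmoothFn E M)⟦X⟧) :
    opTMap star p hJ (m + 1) f = - ∑ j : Fin (m + 1),
      opTMap star p hJ (m - j) (star.opSeries (j + 1) (p.component f) (constraintSeries J)) := by
  rw [opTMap, LinearMap.neg_apply, LinearMap.sum_apply]
  rfl

theorem opT_eq_opTMap (n : ℕ) (f : (SmoothFn E M)⟦X⟧) : opT star p n f = opTMap star p hJ n f := by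
  induction n using Nat.strong_induction_on generalizing f with
  | _ n ih =>
    cases n with
    | zero => rw [opT, opTMap_zero]
    | succ m =>
      rw [opT, opTMap_succ]
      exact congrArg _ (Finset.sum_congr rfl fun j _ => ih _ (by omega) _)

/-- `∑ λ^n T_n` is a left inverse of `g ↦ prol(g) + pr_J(g) * J`. -/
theorem formalSumMap_opTMap_apply (g : (SmoothFn E M)⟦X⟧) :
    formalSumMap (opTMap star p hJ)
      (p.prol g + star.mul (p.component g) (constraintSeries J)) = g := by
  -- The order-zero part `prol(g) + pr_J(g) J` is `g` itself; the higher terms are those that enter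
  -- the recursion for `T_n`.
  have h1 : p.prol g + star.mul (p.component g) (constraintSeries J) = formalSum fun k =>
      if k = 0 then g else star.opSeries k (p.component g) (constraintSeries J) := by
    rw [StarProduct.mul, formalSum_eq_add_X_smul, formalSum_eq_add_X_smul (fun k => if k = 0 then _
      else _), star.opSeries_zero, ← p.sub_prol_eq hJ, ← add_assoc, add_sub_cancel]
    rfl
  rw [h1, formalSumMap_apply]
  simp only [map_formalSum]
  rw [formalSum_formalSum, formalSum_eq_add_X_smul]
  have h2 : ∀ n, ∑ q ∈ Finset.HasAntidiagonal.antidiagonal (n + 1), opTMap star p hJ q.1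
      (if q.2 = 0 then g else star.opSeries q.2 (p.component g) (constraintSeries J)) = 0 := by
    intro n
    rw [← Finset.Nat.sum_antidiagonal_swap, Finset.Nat.antidiagonal_succ, Finset.sum_cons,
      Finset.sum_map, Finset.Nat.sum_antidiagonal_eq_sum_range_succ_mk,
      ← Fin.sum_univ_eq_sum_range]
    dsimp only [Prod.swap]
    rw [if_pos rfl, opTMap_succ]
    exact neg_add_cancel _
  simp only [h2, formalSum_zero]
  simp [opTMap_zero]

theorem formalSumMap_opTMap_injective : Function.Injective (formalSumMap (opTMap star p hJ)) :=
  formalSumMap_injective (opTMap_zero star p hJ)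

theorem mem_starIdeal_iff {f : (SmoothFn E M)⟦X⟧} :
    f ∈ starIdeal star J ↔
      restrictSeries E (constraintSurface J) (formalSumMap (opTMap star p hJ) f) = 0 := by
  constructor
  · rintro ⟨h, rfl⟩
    have hz := restrictSeries_mul_constraintSeries (J := J) h
    have hp := p.prol_eq_zero hz
    have hc : p.component (h * constraintSeries J) = h := p.component_eq hJ (by rw [hp, sub_zero])
    have := formalSumMap_opTMap_apply star p hJ (h * constraintSeries J)
    rw [hp, hc, zero_add] at this
    rw [this, hz]
  · intro hz
    -- Injectivity upgrades the left inverse to a two-sided one: `T A T f = T f` gives `A T f = f`.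
    -- Here `prol(T f) = 0`, so `f = pr_J(T f) * J`.
    have h := formalSumMap_opTMap_injective star p hJ
      (formalSumMap_opTMap_apply star p hJ (formalSumMap (opTMap star p hJ) f))
    rw [p.prol_eq_zero hz, zero_add] at h
    exact ⟨_, h.symm⟩

end Ideal

/-! ### The operators `S_n` -/

section Recursion

variable {E : Type*} [NormedAddCommGroup E] [NormedSpace ℝ E]
  {M : Type*} [TopologicalSpace M] [ChartedSpace E M]
  {Ω : SymplecticForm E M} {J : C^∞⟮𝓘(ℝ, E), M; ℝ⟯} (star : StarProduct Ω)

/-- The bounds `k ≥ 2`, respectively `i, k ≥ 1`, leave only `S_0, …, S_{n-1}` in `F_{n+1}`; this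
makes the recursion for `S_n` well founded. -/
theorem opF_congr {S S' T T' : ℕ → (SmoothFn E M)⟦X⟧ → (SmoothFn E M)⟦X⟧} {n : ℕ}
    {f : (SmoothFn E M)⟦X⟧} (hS : ∀ m < n, S m f = S' m f) (hT : ∀ m g, T m g = T' m g) :
    opF star J S T (n + 1) f = opF star J S' T' (n + 1) f := by
  unfold opF
  congr 1
  · refine Finset.sum_congr rfl fun k hk => ?_
    rw [Finset.mem_Icc] at hk
    rw [hS _ (by omega)]
  · refine Finset.sum_congr rfl fun i hi => Finset.sum_congr rfl fun k hk => ?_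
    rw [Finset.mem_Icc] at hi hk
    rw [hS _ (by omega), hT]

/-- `F_n[S; T]` as a linear map. -/
noncomputable def opFMap (J : C^∞⟮𝓘(ℝ, E), M; ℝ⟯)
    (S T : ℕ → (SmoothFn E M)⟦X⟧ →ₗ[ℂ⟦X⟧] (SmoothFn E M)⟦X⟧) (n : ℕ) :
    (SmoothFn E M)⟦X⟧ →ₗ[ℂ⟦X⟧] (SmoothFn E M)⟦X⟧ :=
  ∑ k ∈ Finset.Icc 2 n, star.antisymmMap k (constraintSeries J) ∘ₗ S (n - k) +
    ∑ i ∈ Finset.Icc 1 (n - 1), ∑ k ∈ Finset.Icc 1 (n - i),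
      T i ∘ₗ star.antisymmMap k (constraintSeries J) ∘ₗ S (n - k - i)

theorem opFMap_apply (S T : ℕ → (SmoothFn E M)⟦X⟧ →ₗ[ℂ⟦X⟧] (SmoothFn E M)⟦X⟧) (n : ℕ)
    (f : (SmoothFn E M)⟦X⟧) :
    opFMap star J S T n f = opF star J (fun n => S n) (fun n => T n) n f := by
  simp only [opFMap, opF, LinearMap.add_apply, LinearMap.sum_apply, LinearMap.comp_apply,
    StarProduct.antisymmMap_apply]

/-- A prolonged series is determined by its restriction to `C`. Every point of `C` lies on an orbit
from `σ`, so the integral formula fixes that restriction; linearity of the competitors plays no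
role. -/
theorem IsRecursionS.unique {p : Prolongation J} {D : Set (ℝ × M)} {Φ : ℝ × M → M} {σ : Set M}
    (hσ : IsTransversalSection Ω J D Φ σ)
    {S S' : ℕ → (SmoothFn E M)⟦X⟧ → (SmoothFn E M)⟦X⟧} (hS : IsRecursionS star p D Φ σ S)
    (hS' : IsRecursionS star p D Φ σ S') (n : ℕ) (f : (SmoothFn E M)⟦X⟧) : S n f = S' n f := by
  induction n using Nat.strong_induction_on with
  | _ n ih =>
    rcases Nat.eq_zero_or_pos n with rfl | hn
    · rw [hS.zero, hS'.zero]
    · rw [hS.prolonged n hn, hS'.prolonged n hn]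
      refine congrArg p.extend (PowerSeries.ext fun m => ?_)
      rw [coeff_restrictSeries, coeff_restrictSeries]
      refine Subtype.ext (funext fun x => ?_)
      obtain ⟨⟨t, s⟩, ⟨hts, hs, hx⟩, -⟩ := hσ.existsUnique x x.2
      change (PowerSeries.coeff m (S n f)).1 x = (PowerSeries.coeff m (S' n f)).1 x
      rw [← hx, hS.onSurface n hn f s hs t hts, hS'.onSurface n hn f s hs t hts,
        opF_congr star ih fun _ _ => rfl]

/-- This isolates the pair `(i, k) = (0, 1)`, the transport term, from the sums that make up
`F_{n+1}`. The terms with `k = 0` drop out because `M_0` is commutative. -/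
theorem sum_antidiagonal_antidiagonal {G : Type*} [AddCommMonoid G] (g : ℕ → ℕ → ℕ → G)
    (hg : ∀ i m, g i 0 m = 0) (n : ℕ) :
    ∑ q ∈ Finset.HasAntidiagonal.antidiagonal (n + 1),
      ∑ r ∈ Finset.HasAntidiagonal.antidiagonal q.2, g q.1 r.1 r.2 =
    g 0 1 n + (∑ k ∈ Finset.Icc 2 (n + 1), g 0 k (n + 1 - k) +
      ∑ i ∈ Finset.Icc 1 n, ∑ k ∈ Finset.Icc 1 (n + 1 - i), g i k (n + 1 - k - i)) := by
  have hinner : ∀ i j, ∑ r ∈ Finset.HasAntidiagonal.antidiagonal j, g i r.1 r.2 =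
      ∑ k ∈ Finset.Icc 1 j, g i k (j - k) := by
    intro i j
    rw [Finset.Nat.sum_antidiagonal_eq_sum_range_succ (g i), Finset.range_eq_Ico,
      Finset.sum_eq_sum_Ico_succ_bot (Nat.succ_pos j), hg, zero_add]
    rfl
  simp only [hinner]
  rw [Finset.Nat.sum_antidiagonal_eq_sum_range_succ (fun i j => ∑ k ∈ Finset.Icc 1 j, g i k (j - k)),
    Finset.range_eq_Ico, Finset.sum_eq_sum_Ico_succ_bot (Nat.succ_pos _),
    Finset.sum_Ico_succ_top (by omega), Nat.sub_self, Finset.Icc_eq_empty (by omega : ¬ 1 ≤ 0),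
    Finset.sum_empty, add_zero, ← add_assoc, Nat.sub_zero]
  refine congrArg₂ (· + ·) ?_ ?_
  · rw [show Finset.Icc 1 (n + 1) = Finset.Ico 1 (n + 1 + 1) from rfl,
      Finset.sum_eq_sum_Ico_succ_bot (by omega)]
    rfl
  · rw [show Finset.Icc 1 n = Finset.Ico 1 (n + 1) from rfl]
    refine Finset.sum_congr rfl fun i _ => Finset.sum_congr rfl fun k _ => ?_
    rw [Nat.sub_right_comm]

variable [FiniteDimensional ℝ E] [T2Space M] [IsManifold 𝓘(ℝ, E) ∞ M] (p : Prolongation J)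
  (hJ : ∀ x ∈ constraintSurface J, mfderiv 𝓘(ℝ, E) 𝓘(ℝ, ℝ) J x ≠ 0)
  {D : Set (ℝ × M)} {Φ : ℝ × M → M} (hΦ : IsFlow (hamiltonianVectorField Ω J) D Φ)
  {σ : Set M} (hσ : IsTransversalSection Ω J D Φ σ)

/-- The operators `S_n` as linear maps. -/
noncomputable def opSMap : ℕ → (SmoothFn E M)⟦X⟧ →ₗ[ℂ⟦X⟧] (SmoothFn E M)⟦X⟧
  | 0 => LinearMap.id
  | n + 1 => p.extend ∘ₗ mapCoeff (orbitIntegralMap hΦ hσ) ∘ₗ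
      -- The guard only exhibits termination; by `opF_congr` it does not change `F_{n+2}`, which
      -- sees `S_m` for `m ≤ n` only.
      opFMap star J (fun m => if _ : m < n + 1 then opSMap m else 0) (opTMap star p hJ) (n + 2)
  termination_by n => n

theorem opSMap_zero (f : (SmoothFn E M)⟦X⟧) : opSMap star p hJ hΦ hσ 0 f = f := by
  rw [opSMap, LinearMap.id_apply]

theorem opSMap_of_pos {n : ℕ} (hn : 1 ≤ n) (f : (SmoothFn E M)⟦X⟧) :
    opSMap star p hJ hΦ hσ n f = p.extend (mapCoeff (orbitIntegralMap hΦ hσ)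
      (opF star J (fun m => opSMap star p hJ hΦ hσ m) (opT star p) (n + 1) f)) := by
  obtain ⟨n, rfl⟩ := Nat.exists_eq_add_of_le' hn
  rw [opSMap, LinearMap.comp_apply, LinearMap.comp_apply, opFMap_apply]
  congr 2
  refine opF_congr star (fun m hm => ?_) fun m g => (opT_eq_opTMap star p hJ m g).symm
  simp only [dif_pos hm]

theorem restrictSeries_opSMap {n : ℕ} (hn : 1 ≤ n) (f : (SmoothFn E M)⟦X⟧) :
    restrictSeries E (constraintSurface J) (opSMap star p hJ hΦ hσ n f) =
      mapCoeff (orbitIntegralMap hΦ hσ)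
        (opF star J (fun m => opSMap star p hJ hΦ hσ m) (opT star p) (n + 1) f) := by
  rw [opSMap_of_pos star p hJ hΦ hσ hn, p.restrict_extend]

theorem restrict_coeff_opSMap {n : ℕ} (hn : 1 ≤ n) (f : (SmoothFn E M)⟦X⟧) (m : ℕ) :
    restrict E (constraintSurface J) (PowerSeries.coeff m (opSMap star p hJ hΦ hσ n f)) =
      orbitIntegralMap hΦ hσ (PowerSeries.coeff m
        (opF star J (fun m => opSMap star p hJ hΦ hσ m) (opT star p) (n + 1) f)) := by
  rw [← coeff_restrictSeries, restrictSeries_opSMap star p hJ hΦ hσ hn, coeff_mapCoeff]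

theorem isRecursionS_opSMap :
    IsRecursionS star p D Φ σ (fun n => opSMap star p hJ hΦ hσ n) where
  zero := opSMap_zero star p hJ hΦ hσ
  onSurface n hn f s hs t hts m := by
    have hC := hΦ.mem_constraintSurface hts (hσ.subset hs)
    rw [← orbitIntegralMap_apply hΦ hσ _ hs hts hC, ← restrict_coeff_opSMap star p hJ hΦ hσ hn]
    rfl
  prolonged n hn f := by
    rw [opSMap_of_pos star p hJ hΦ hσ hn, p.prol_extend]

/-- The transport equation satisfied by `S_n f` on the constraint surface. -/
theorem restrictSeries_transport {n : ℕ} (hn : 1 ≤ n) (f : (SmoothFn E M)⟦X⟧) :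
    restrictSeries E (constraintSurface J)
      (star.antisymm 1 (constraintSeries J) (opSMap star p hJ hΦ hσ n f) +
        opF star J (fun m => opSMap star p hJ hΦ hσ m) (opT star p) (n + 1) f) = 0 := by
  refine restrictSeries_eq_zero_iff.2 fun m x hx => ?_
  rw [map_add]
  change (PowerSeries.coeff m (star.antisymm 1 _ _)).1 x + _ = 0
  -- `M⁻_1(J, ·)` is `-i X_J`, and `X_J(S_n f) = -i F_{n+1}(f)`; the product `(-i)(-i) = -1`
  -- produces the cancellation.
  rw [star.coeff_antisymm_one_apply, dC_of_restrict_eq_orbitIntegralMap hΦ hσ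
    (restrict_coeff_opSMap star p hJ hΦ hσ hn f m) hx, ← mul_assoc, neg_mul_neg, Complex.I_mul_I,
    neg_one_mul, neg_add_cancel]

/-- This is where the recursion pays off: expanded as a formal sum, the left side has zero term at
index `0`, and from index `2` on its terms vanish on `C` by `restrictSeries_transport`. -/
theorem restrictSeries_commutator (f : (SmoothFn E M)⟦X⟧) :
    restrictSeries E (constraintSurface J) (formalSumMap (opTMap star p hJ)
      (star.mul (constraintSeries J) (formalSumMap (opSMap star p hJ hΦ hσ) f) -
        star.mul (formalSumMap (opSMap star p hJ hΦ hσ) f) (constraintSeries J))) =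
      (PowerSeries.X : ℂ⟦X⟧) • restrictSeries E (constraintSurface J)
        (star.antisymm 1 (constraintSeries J) f) := by
  set T := opTMap star p hJ
  set S := opSMap star p hJ hΦ hσ
  let g : ℕ → ℕ → ℕ → (SmoothFn E M)⟦X⟧ := fun i k m =>
    T i (star.antisymmMap k (constraintSeries J) (S m f))
  let a : ℕ → (SmoothFn E M)⟦X⟧ := fun n => ∑ q ∈ Finset.HasAntidiagonal.antidiagonal n,
    ∑ r ∈ Finset.HasAntidiagonal.antidiagonal q.2, g q.1 r.1 r.2
  have hg : ∀ i m, g i 0 m = 0 := fun i m => by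
    simp only [g]
    rw [StarProduct.antisymmMap_apply, star.antisymm_zero, map_zero]
  have hsum : formalSumMap T (star.mul (constraintSeries J) (formalSumMap S f) -
      star.mul (formalSumMap S f) (constraintSeries J)) = formalSum a := by
    rw [star.mul_sub_mul_eq, formalSumMap_apply T]
    simp only [formalSumMap_apply, ← StarProduct.antisymmMap_apply, map_formalSum,
      formalSum_formalSum, map_sum]
    rfl
  have ha0 : a 0 = 0 := by simp [a, hg]
  have ha : ∀ n, a (n + 1) = star.antisymm 1 (constraintSeries J) (S n f) +
      opF star J (fun m => S m) (opT star p) (n + 1) f := fun n => by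
    have hT : opT star p = fun n f => T n f := funext fun n => funext (opT_eq_opTMap star p hJ n)
    rw [hT]
    refine (sum_antidiagonal_antidiagonal g hg n).trans ?_
    simp only [g, T, opTMap_zero, opF, StarProduct.antisymmMap_apply, Nat.add_sub_cancel]
  -- The sums in `F_1` are empty, so at index `1` only the transport term of `S_0 f = f` remains.
  have ha1 : a 1 = star.antisymm 1 (constraintSeries J) f := by
    have hS : S 0 f = f := opSMap_zero star p hJ hΦ hσ f
    rw [ha, hS]
    simp [opF]
  have ha2 : ∀ n, restrictSeries E (constraintSurface J) (a (n + 1 + 1)) = 0 := fun n => by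
    rw [ha]
    exact restrictSeries_transport star p hJ hΦ hσ (Nat.succ_pos n) f
  rw [hsum, map_formalSum, formalSum_eq_add_X_smul, ha0, map_zero, zero_add,
    formalSum_eq_add_X_smul, zero_add, ha1]
  simp only [ha2, formalSum_zero, smul_zero, add_zero]

/-- Both sides reduce to `X_J f = 0` on `C`, since the factors `λ` and `-i` can be cancelled. No
membership in `F` is needed. -/
theorem formalSumMap_opSMap_mem_starB_iff (f : (SmoothFn E M)⟦X⟧) :
    formalSumMap (opSMap star p hJ hΦ hσ) f ∈ starB star J ↔ f ∈ classicalB Ω J := by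
  rw [mem_starB_iff, mem_starIdeal_iff star p hJ, restrictSeries_commutator, mem_classicalB_iff hJ,
    ← smul_zero (PowerSeries.X : ℂ⟦X⟧), X_smul_injective.eq_iff, restrictSeries_eq_zero_iff]
  simp only [star.coeff_antisymm_one_apply, mul_eq_zero, neg_eq_zero, Complex.I_ne_zero, false_or]

theorem opSMap_mem_pure (n : ℕ) {f : (SmoothFn E M)⟦X⟧} (hf : f ∈ p.pure) :
    opSMap star p hJ hΦ hσ n f ∈ p.pure := by
  rcases Nat.eq_zero_or_pos n with rfl | hn
  · rwa [opSMap_zero]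
  · rw [p.mem_pure, opSMap_of_pos star p hJ hΦ hσ hn, p.prol_extend]

end Recursion

end StarReduction

/-! ### The isomorphism of `B ∩ F` with `B^* ∩ F` -/

theorem mainTheorem2
    {E : Type*} [NormedAddCommGroup E] [NormedSpace ℝ E] [FiniteDimensional ℝ E]
    {M : Type*} [TopologicalSpace M] [T2Space M] [SecondCountableTopology M]
    [ChartedSpace E M] [IsManifold 𝓘(ℝ, E) ∞ M]
    (Ω : SymplecticForm E M) (star : StarProduct Ω)
    (J : C^∞⟮𝓘(ℝ, E), M; ℝ⟯)
    (hJ : ∀ x ∈ constraintSurface J, mfderiv 𝓘(ℝ, E) 𝓘(ℝ, ℝ) J x ≠ 0)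
    (p : Prolongation J)
    (D : Set (ℝ × M)) (Φ : ℝ × M → M) (hΦ : IsFlow (hamiltonianVectorField Ω J) D Φ)
    (σ : Set M) (hσ : IsTransversalSection Ω J D Φ σ) :
    ∃ S : ℕ → (SmoothFn E M)⟦X⟧ →ₗ[ℂ⟦X⟧] (SmoothFn E M)⟦X⟧,
      IsRecursionS star p D Φ σ (fun n => S n) ∧
      (∀ S' : ℕ → (SmoothFn E M)⟦X⟧ → (SmoothFn E M)⟦X⟧,
        IsRecursionS star p D Φ σ S' → ∀ n f, S' n f = S n f) ∧
      ∃ e : (classicalB Ω J ⊓ p.pure : Submodule ℂ⟦X⟧ (SmoothFn E M)⟦X⟧) ≃ₗ[ℂ⟦X⟧]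
          (starB star J ⊓ p.pure : Submodule ℂ⟦X⟧ (SmoothFn E M)⟦X⟧),
        ∀ f, (e f : (SmoothFn E M)⟦X⟧) =
          formalSum fun n => S n (f : (SmoothFn E M)⟦X⟧) := by
  have hrec := isRecursionS_opSMap star p hJ hΦ hσ
  have h0 := opSMap_zero star p hJ hΦ hσ
  have hiff := formalSumMap_opSMap_mem_starB_iff star p hJ hΦ hσ
  have hmaps : ∀ f ∈ classicalB Ω J ⊓ p.pure,
      formalSumMap (opSMap star p hJ hΦ hσ) f ∈ starB star J ⊓ p.pure := fun f hf =>
    ⟨(hiff f).2 hf.1, p.formalSum_mem_pure fun n => opSMap_mem_pure star p hJ hΦ hσ n hf.2⟩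
  refine ⟨opSMap star p hJ hΦ hσ, hrec, fun S' hS' n f => hS'.unique star hσ hrec n f,
    LinearEquiv.ofBijective ((formalSumMap (opSMap star p hJ hΦ hσ)).restrict hmaps) ⟨?_, ?_⟩,
    fun f => rfl⟩
  · intro f g hfg
    exact Subtype.ext (formalSumMap_injective h0 (congrArg Subtype.val hfg))
  · rintro ⟨h, hB, hF⟩
    -- The formal inverse supplies the preimage. It lies in `F` because every `S_n` preserves `F`,
    -- and in `B` by the equivalence `hiff` read backwards.
    have heq := formalSumMap_inverseCoeff h0 h
    refine ⟨⟨formalSum (inverseCoeff (opSMap star p hJ hΦ hσ) h), (hiff _).1 (by rwa [heq]),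
      p.formalSum_mem_pure fun n => inverseCoeff_mem
        (fun n f hf => opSMap_mem_pure star p hJ hΦ hσ n hf) hF n⟩, Subtype.ext heq⟩
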